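/- Let $\mathbf A$ and $\mathbf B$ be Grothendieck abelian categories and let $G\colon \mathbf A\to\mathbf B$ be an exact functor that commutes with filtered colimits. Let $\mathrm{Ch}_{dg}(\mathbf A)$ be the $\infty$-category (dg-nerve) of unbounded complexes in $\mathbf A$, let $L_{\mathbf A}\colon \mathrm{Ch}_{dg}(\mathbf A)\to\mathcal D(\mathbf A)$ be its localization at the quasi-isomorphisms, the derived $\infty$-category, and let $i_{\mathbf A}$ be the fully faithful right adjoint of $L_{\mathbf A}$ (whose essential image consists of the K-injective complexes); likewise for $\mathbf B$. Let $\mathcal D(G)\colon\mathcal D(\mathbf A)\to\mathcal D(\mathbf B)$ be the functor induced by $\mathrm{Ch}_{dg}(G)$. An object $P$ of $\mathbf B$ is called *BC-admissible* if for every $Y\in\mathcal D(\mathbf A)$ the Beck–Chevalley map $\mathrm{Ch}_{dg}(G)(i_{\mathbf A}Y)\to i_{\mathbf B}\mathcal D(G)(Y)$ induces an equivalence $$\mathrm{Map}_{\mathrm{Ch}_{dg}(\mathbf B)}(P[0],\mathrm{Ch}_{dg}(G)(i_{\mathbf A}Y))\simeq \mathrm{Map}_{\mathrm{Ch}_{dg}(\mathbf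 B)}(P[0],i_{\mathbf B}\mathcal D(G)(Y)).$$ Suppose that $\mathbf B$ is generated by BC-admissible objects, i.e. there is a class $E$ of BC-admissible objects such that every object of $\mathbf B$ is a quotient of a small direct sum of objects in $E$. Then: 1. $G$ has a pro-left adjoint, i.e. a functor $F\colon\mathbf B\to\mathrm{Pro}(\mathbf A)$ with $\mathrm{Hom}_{\mathrm{Pro}(\mathbf A)}(F(X),Y)\cong\mathrm{Hom}_{\mathbf B}(X,G(Y))$ naturally in $X\in\mathbf B$ and $Y\in\mathbf A$. 2. $\mathcal D(G)$ has a pro-left adjoint, i.e. a functor $LF\colon\mathcal D(\mathbf B)\to\mathrm{Pro}(\mathcal D(\mathbf A))$ of $\infty$-categories with $\mathrm{Map}_{\mathrm{Pro}(\mathcal D(\mathbf A))}(LF(X),Y)\simeq\mathrm{Map}_{\mathcal D(\mathbf B)}(X,\mathcal D(G)(Y))$ naturally in $X\in\mathcal D(\mathbf B)$ and $Y\in\mathcal D(\mathbf A)$. 3. $LF$ is a pro-left derived functor of $F$: for every $X\in\mathbf B$ there is an isomorphism $$\pi_0\,LF(X[0])\cong F(X)$$ in $\mathrm{Pro}(\mathbf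 A)$, compatible with the units of the two pro-adjunctions. Here $\pi_0$ of a pro-object of $\mathcal D(\mathbf A)$ is computed levelwise: $\pi_0(\text{“}\lim_i\text{”}K_i)=\text{“}\lim_i\text{”}H_0(K_i)$. -/

import Mathlib

open CategoryTheory Limits Opposite

universe v u u₁ u₂

noncomputable section

/-! ### Pro-objects of an ordinary category -/

/-- The category of pro-objects of `C`: the opposite of the category of ind-objects of `Cᵒᵖ`. -/
abbrev ProCat (C : Type u) [Category.{v} C] : Type (max u (v + 1)) := (Ind Cᵒᵖ)ᵒᵖ

namespace ProCat

variable {C : Type u} [Category.{v} C]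

variable (C) in
/-- The embedding of `C` in `ProCat C` as the constant pro-objects. -/
def const : C ⥤ ProCat C := (Ind.yoneda (C := Cᵒᵖ)).rightOp

/-- The formal limit `"lim" D` of a small cofiltered diagram `D`. -/
def formalLim {I : Type v} [SmallCategory I] [IsCofiltered I] (D : I ⥤ C) : ProCat C :=
  op ((Ind.lim Iᵒᵖ).obj D.op)

/-- The projection of `"lim" D` to the constant pro-object `D i`. -/
def proj {I : Type v} [SmallCategory I] [IsCofiltered I] (D : I ⥤ C) (i : I) :
    formalLim D ⟶ (const C).obj (D.obj i) :=
  (colimit.ι (D.op ⋙ Ind.yoneda) (op i)).op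

end ProCat

variable {A : Type u₁} [Category.{v} A] {B : Type u₂} [Category.{v} B]

/-- A pro-left adjoint of a functor `G : A ⥤ B`: a functor `F : B ⥤ ProCat A` together with
bijections `Hom (F X, Y) ≃ Hom (X, G Y)` that are natural in `X : B` and `Y : A`. -/
structure ProLeftAdjoint (G : A ⥤ B) where
  functor : B ⥤ ProCat A
  homEquiv (X : B) (Y : A) : (functor.obj X ⟶ (ProCat.const A).obj Y) ≃ (X ⟶ G.obj Y)
  homEquiv_naturality_left {X X' : B} {Y : A} (f : X' ⟶ X)
    (g : functor.obj X ⟶ (ProCat.const A).obj Y) :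
    homEquiv X' Y (functor.map f ≫ g) = f ≫ homEquiv X Y g
  homEquiv_naturality_right {X : B} {Y Y' : A} (g : functor.obj X ⟶ (ProCat.const A).obj Y)
    (h : Y ⟶ Y') :
    homEquiv X Y' (g ≫ (ProCat.const A).map h) = homEquiv X Y g ≫ G.map h

/-! ### Generation -/

/-- `B` is generated by the objects in `E`: every object of `B` is a quotient of a small direct
sum of objects in `E`. (If `E` is closed under direct sums, this says that every object is a
quotient of an object in `E`.) -/
def IsGeneratedBy (E : ObjectProperty B) : Prop :=
  ∀ X : B, ∃ (ι : Type v) (P : ι → B) (c : Cofan P) (_ : IsColimit c) (p : c.pt ⟶ X),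
    (∀ i, E (P i)) ∧ Epi p

variable [Abelian A] [Abelian B]

/-! ### BC-admissible complexes -/

/-- The functor `Ch(G)` on (unbounded) complexes. -/
abbrev mapCh (G : A ⥤ B) [G.Additive] : CochainComplex A ℤ ⥤ CochainComplex B ℤ :=
  G.mapHomologicalComplex (ComplexShape.up ℤ)

/-- A complex `X` in `B` is BC-admissible with respect to `G` if, for every object `Y` of the
derived ∞-category of `A`, the Beck-Chevalley map `Ch(G)(i_A Y) ⟶ i_B D(G)(Y)` induces an
equivalence of mapping spaces `Map (X, Ch(G)(i_A Y)) ≃ Map (X, i_B D(G)(Y))` in the dg-nerve of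
the complexes in `B`. Here `i_A Y` runs through the K-injective complexes `I` in `A`, and the
Beck-Chevalley map is a quasi-isomorphism `j` from `Ch(G)(I)` to a K-injective complex `J`.
The `n`-th homotopy group of `Map (X, Z)` is the group of homotopy classes of maps of
complexes `X ⟶ Z⟦-n⟧`. -/
def IsBCAdmissible (G : A ⥤ B) [G.Additive] (X : CochainComplex B ℤ) : Prop :=
  ∀ (I : CochainComplex A ℤ) (J : CochainComplex B ℤ) (j : (mapCh G).obj I ⟶ J),
    I.IsKInjective → J.IsKInjective → QuasiIso j → ∀ n : ℕ,
      Function.Bijective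
        (fun f : (HomotopyCategory.quotient B (ComplexShape.up ℤ)).obj X ⟶
            (HomotopyCategory.quotient B (ComplexShape.up ℤ)).obj
              (((mapCh G).obj I)⟦(-(n : ℤ))⟧) =>
          f ≫ (HomotopyCategory.quotient B (ComplexShape.up ℤ)).map (j⟦(-(n : ℤ))⟧'))

/-! ### Homotopy coherent diagrams and pro-objects of the derived ∞-category -/

section Derived

attribute [local instance] HasDerivedCategory.standard

/-- Levelwise quasi-isomorphisms of diagrams of complexes. -/
abbrev levelwiseQuasiIso (I : Type v) [SmallCategory I] (B : Type u₂) [Category.{v} B]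
    [Abelian B] : MorphismProperty (I ⥤ CochainComplex B ℤ) :=
  (HomologicalComplex.quasiIso B (ComplexShape.up ℤ)).functorCategory I

/-- The homotopy category of `I`-indexed (homotopy coherent) diagrams in the derived ∞-category
of `B`, obtained from the strict diagrams of complexes by inverting the levelwise
quasi-isomorphisms. -/
abbrev HoDiag (I : Type v) [SmallCategory I] (B : Type u₂) [Category.{v} B] [Abelian B] :=
  (levelwiseQuasiIso I B).Localization

lemma evaluation_comp_Q_inverts (I : Type v) [SmallCategory I] (i : I) :
    (levelwiseQuasiIso I B).IsInvertedBy
      ((evaluation I (CochainComplex B ℤ)).obj i ⋙ DerivedCategory.Q) := by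
  intro D D' f hf
  have : QuasiIso (f.app i) := hf i
  dsimp
  infer_instance

/-- The value at `i : I` of a morphism of homotopy coherent diagrams. -/
def HoDiag.eval {I : Type v} [SmallCategory I] {D D' : I ⥤ CochainComplex B ℤ}
    (η : (levelwiseQuasiIso I B).Q.obj D ⟶ (levelwiseQuasiIso I B).Q.obj D') (i : I) :
    DerivedCategory.Q.obj (D.obj i) ⟶ DerivedCategory.Q.obj (D'.obj i) :=
  let e := Localization.fac _ (evaluation_comp_Q_inverts (B := B) I i) (levelwiseQuasiIso I B).Q
  e.inv.app D ≫
    (Localization.lift _ (evaluation_comp_Q_inverts (B := B) I i) (levelwiseQuasiIso I B).Q).map η ≫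
      e.hom.app D'

variable (G : A ⥤ B) [G.Additive] [PreservesFiniteLimits G] [PreservesFiniteColimits G]

/-- The action of `D(G)` on morphisms in the derived category between (the images of) two
complexes. -/
def mapDerived {K L : CochainComplex A ℤ}
    (g : DerivedCategory.Q.obj K ⟶ DerivedCategory.Q.obj L) :
    DerivedCategory.Q.obj ((mapCh G).obj K) ⟶ DerivedCategory.Q.obj ((mapCh G).obj L) :=
  G.mapDerivedCategoryFactors.inv.app K ≫ G.mapDerivedCategory.map g ≫
    G.mapDerivedCategoryFactors.hom.app L

/-- The value at `X` of the pro-left adjoint of `D(G)`, where `X` is a complex in `B`, regarded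
as an object of the derived ∞-category `D(B)`: a pro-object `"lim" K` of the ∞-category `D(A)`,
given by a diagram `K` of complexes indexed by a small cofiltered category `I`, and a universal
cone `X ⟶ D(G)(K i)`.

The cone is homotopy coherent, that is, a morphism `unit` in the homotopy category of diagrams
from the constant diagram `X` to `D(G) ∘ K`. It amounts to a natural transformation
`colim_i Map_{D(A)} (K i, Y) ⟶ Map_{D(B)} (X, D(G) Y)` of space-valued functors of `Y` in `D(A)`,
and the last two fields say that this is an equivalence: since `Y` runs through all complexes,
hence all shifts, this amounts to the bijectivity of the map
`colim_i Hom_{D(A)} (K i, Y) ⟶ Hom_{D(B)} (X, D(G) Y)` on connected components. -/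
structure DerivedProLeftAdjointAt (X : CochainComplex B ℤ) where
  I : Type v
  [category : SmallCategory I]
  [isCofiltered : IsCofiltered I]
  K : I ⥤ CochainComplex A ℤ
  unit : (levelwiseQuasiIso I B).Q.obj ((Functor.const I).obj X) ⟶
    (levelwiseQuasiIso I B).Q.obj (K ⋙ mapCh G)
  surjective (Y : CochainComplex A ℤ)
    (f : DerivedCategory.Q.obj X ⟶ DerivedCategory.Q.obj ((mapCh G).obj Y)) :
    ∃ (i : I) (g : DerivedCategory.Q.obj (K.obj i) ⟶ DerivedCategory.Q.obj Y),
      HoDiag.eval unit i ≫ mapDerived G g = f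
  injective (Y : CochainComplex A ℤ) (i : I)
    (g g' : DerivedCategory.Q.obj (K.obj i) ⟶ DerivedCategory.Q.obj Y)
    (h : HoDiag.eval unit i ≫ mapDerived G g = HoDiag.eval unit i ≫ mapDerived G g') :
    ∃ (i' : I) (φ : i' ⟶ i),
      DerivedCategory.Q.map (K.map φ) ≫ g = DerivedCategory.Q.map (K.map φ) ≫ g'

attribute [instance] DerivedProLeftAdjointAt.category DerivedProLeftAdjointAt.isCofiltered

/-- A pro-left adjoint `LF : D(B) ⥤ Pro-D(A)` of the functor `D(G) : D(A) ⥤ D(B)` of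
∞-categories. Like any (relative) adjoint functor, it amounts to the choice, for every object `X`
of `D(B)`, of an object of `Pro-D(A)` with a universal arrow from `X`. -/
abbrev DerivedProLeftAdjoint : Type _ :=
  ∀ X : CochainComplex B ℤ, DerivedProLeftAdjointAt G X

variable {G}

namespace DerivedProLeftAdjointAt

/-- `π₀` of the pro-object `"lim" K`, for the levelwise t-structure on `Pro-D(A)`. -/
def piZero {X : CochainComplex B ℤ} (L : DerivedProLeftAdjointAt G X) : ProCat A :=
  ProCat.formalLim (L.K ⋙ HomologicalComplex.homologyFunctor A (ComplexShape.up ℤ) 0)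

/-- For an object `X` of `B`, the map `X ≅ H⁰(X[0]) ⟶ H⁰(Ch(G)(K i)) ≅ G(H⁰(K i))` induced by
the universal cone. -/
def piZeroUnit {X : B}
    (L : DerivedProLeftAdjointAt G ((HomologicalComplex.single B (ComplexShape.up ℤ) 0).obj X))
    (i : L.I) : X ⟶ G.obj ((L.K.obj i).homology 0) :=
  (HomologicalComplex.singleObjHomologySelfIso (ComplexShape.up ℤ) 0 X).inv ≫
    (DerivedCategory.homologyFunctorFactors B 0).inv.app _ ≫
    (DerivedCategory.homologyFunctor B 0).map (HoDiag.eval L.unit i) ≫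
    (DerivedCategory.homologyFunctorFactors B 0).hom.app _ ≫
    (((L.K.obj i).sc 0).mapHomologyIso G).hom

end DerivedProLeftAdjointAt

/-- `LF` is a pro-left derived functor of `F`: there is, for every object `X` of `B`, an
isomorphism `π₀ (LF (X[0])) ≅ F X` of pro-objects of `A`. The isomorphism is moreover required to
be the canonical one, i.e. compatible with the units of the two pro-adjunctions (which makes it
natural in `X`). -/
def IsProLeftDerivedFunctor (LF : DerivedProLeftAdjoint G) (F : ProLeftAdjoint G) : Prop :=
  ∀ X : B,
    ∃ e : (LF ((HomologicalComplex.single B (ComplexShape.up ℤ) 0).obj X)).piZero ≅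
        F.functor.obj X,
      ∀ i, F.homEquiv X _ (e.inv ≫ ProCat.proj _ i) =
        (LF ((HomologicalComplex.single B (ComplexShape.up ℤ) 0).obj X)).piZeroUnit i

end Derived

end

/-! The proof rests on one principle. Let `H` be a left exact functor between Grothendieck abelian
categories that preserves filtered colimits. The category of arrows `X ⟶ H Y` is cofiltered by left
exactness. A small set of such arrows maps to all others, because each one factors through `H` of a
subobject of `Y` generated by a bounded number of maps from a separator (`exists_solutionSet`).
Hence `Hom (X, H -)` is a small filtered colimit of corepresentable functors
(`exists_cofiltered_cone`). For `H = G` this is the pro-left adjoint `F`.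

For `D(G)` the principle is applied to `mapCh G` and to a resolution `M` of `X` built from cells on
BC-admissible objects. If `I` is K-injective and `J` is a K-injective replacement of `Ch(G)(I)`, the
cone of `Ch(G)(I) ⟶ J` is acyclic as seen by each admissible object, so every map from `M` to it is
null-homotopic. Therefore homotopy classes of maps `M ⟶ Ch(G)(I)` compute maps in the derived
category (`IsCellular.bijective_Qh_map`). Homotopies descend to a stage of the pro-object because
`mapCh G` commutes with path objects (`exists_Q_map_eq_of_homotopy`).

Both resolutions come from the small object argument. For the K-injective one, a small set must
generate all acyclic monomorphisms; this holds because nonzero acyclic complexes contain nonzero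
acyclic subcomplexes of bounded size (`exists_detectsAcyclic`).

Finally, the `H⁰` of the universal cone at `X[0]` pro-corepresents `Hom (X, G -)`: it is tested on
`Y[0]` for surjectivity, and on `J[0]` with `Y` embedded in an injective `J` for injectivity. -/

noncomputable section

/-! ### Exact colimits, homology, and closure properties of acyclic monomorphisms. -/

namespace CategoryTheory.Limits

variable {C D J : Type*} [Category* C] [Category* D] [Category* J] [Abelian D]

/-- A functor that is the kernel of a transformation between functors preserving colimits of
shape `J` preserves them as well if these colimits are exact. -/
lemma preservesColimitsOfShape_of_kernel [HasColimitsOfShape J D]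
    [HasExactColimitsOfShape J D] {K F F' : C ⥤ D} (ι : K ⟶ F) (η : F ⟶ F')
    (w : ∀ X, ι.app X ≫ η.app X = 0) (h : ∀ X, (ShortComplex.mk _ _ (w X)).Exact)
    [∀ X, Mono (ι.app X)] [PreservesColimitsOfShape J F] [PreservesColimitsOfShape J F'] :
    PreservesColimitsOfShape J K where
  preservesColimit {Δ} := ⟨fun {c} hc => by
    let S : ShortComplex (J ⥤ D) :=
      ShortComplex.mk (Functor.whiskerLeft Δ ι) (Functor.whiskerLeft Δ η) (by ext; simp [w])
    have hS : S.Exact := by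
      rw [ShortComplex.exact_iff_isZero_homology, Functor.isZero_iff]
      intro j
      exact (ShortComplex.exact_iff_isZero_homology _).1 (h (Δ.obj j)) |>.of_iso
        (S.mapHomologyIso ((evaluation J D).obj j)).symm
    have : Mono S.f := by
      have : ∀ j, Mono (S.f.app j) := fun j => inferInstanceAs (Mono (ι.app _))
      exact NatTrans.mono_of_mono_app _
    let d := colimit.desc (Δ ⋙ K) (K.mapCocone c)
    have hd (j : J) : colimit.ι (Δ ⋙ K) j ≫ d = K.map (c.ι.app j) := colimit.ι_desc _ _
    have ex := colim.exact_mapShortComplex hS (colimit.isColimit S.X₁)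
      (isColimitOfPreserves F hc) (isColimitOfPreserves F' hc)
      (d ≫ ι.app c.pt) (η.app c.pt) (fun j => by
        simpa [S] using congr($(hd j) ≫ ι.app c.pt)) (fun j => by simp [S])
    have : Mono (d ≫ ι.app c.pt) := colim.map_mono' S.f (colimit.isColimit S.X₁)
      (isColimitOfPreserves F hc) _ (fun j => by
        simpa [S] using congr($(hd j) ≫ ι.app c.pt))
    have : Mono d := mono_of_mono d (ι.app c.pt)
    have : IsIso d := by
      -- The row of colimits is exact, so `ι` lifts to its first term; the lift is a section of the
      -- monomorphism `d`.
      obtain ⟨s, hs⟩ : ∃ s, s ≫ d ≫ ι.app c.pt = ι.app c.pt :=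
        have : Mono (colim.mapShortComplex S (colimit.isColimit S.X₁) (F.mapCocone c)
          (F'.mapCocone c) (d ≫ ι.app c.pt) (η.app c.pt) _ _).f := ‹Mono (d ≫ ι.app c.pt)›
        ⟨ex.lift (ι.app c.pt) (w c.pt), ex.lift_f _ _⟩
      have : s ≫ d = 𝟙 _ := by
        rw [← cancel_mono (ι.app c.pt)]
        simpa using hs
      exact ⟨s, by rw [← cancel_mono d, Category.assoc, this]; simp, this⟩
    exact ⟨IsColimit.ofPointIso (colimit.isColimit (Δ ⋙ K)) (i := this)⟩⟩

/-- A functor that is the cokernel of a transformation between functors preserving colimits of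
shape `J` preserves them as well. -/
lemma preservesColimitsOfShape_of_cokernel {F F' K : C ⥤ D} (η : F ⟶ F') (π : F' ⟶ K)
    (w : ∀ X, η.app X ≫ π.app X = 0) (h : ∀ X, (ShortComplex.mk _ _ (w X)).Exact)
    [∀ X, Epi (π.app X)] [PreservesColimitsOfShape J F] [PreservesColimitsOfShape J F'] :
    PreservesColimitsOfShape J K where
  preservesColimit {Δ} := ⟨fun {c} hc => by
    let t (s : Cocone (Δ ⋙ K)) : Cocone (Δ ⋙ F') :=
      (Cocone.precompose (Functor.whiskerLeft Δ π)).obj s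
    let δ (s : Cocone (Δ ⋙ K)) : F'.obj c.pt ⟶ s.pt := (isColimitOfPreserves F' hc).desc (t s)
    have fac (s : Cocone (Δ ⋙ K)) (j : J) :
        F'.map (c.ι.app j) ≫ δ s = π.app (Δ.obj j) ≫ s.ι.app j :=
      (isColimitOfPreserves F' hc).fac (t s) j
    have zero (s : Cocone (Δ ⋙ K)) : η.app c.pt ≫ δ s = 0 := by
      refine (isColimitOfPreserves F hc).hom_ext (fun j => ?_)
      have := w (Δ.obj j)
      dsimp at this ⊢
      rw [NatTrans.naturality_assoc, fac, reassoc_of% this, zero_comp, comp_zero]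
    have : Epi (ShortComplex.mk _ _ (w c.pt)).g := inferInstanceAs (Epi (π.app c.pt))
    have hdesc (s : Cocone (Δ ⋙ K)) : π.app c.pt ≫ (h c.pt).desc (δ s) (zero s) = δ s :=
      (h c.pt).g_desc _ _
    refine ⟨⟨fun s => (h c.pt).desc (δ s) (zero s), fun s j => ?_, fun s m hm => ?_⟩⟩
    · have := hdesc s
      dsimp at this ⊢
      rw [← cancel_epi (π.app _), ← NatTrans.naturality_assoc, this, fac]
    · rw [← cancel_epi (π.app _), hdesc]
      refine (isColimitOfPreserves F' hc).hom_ext (fun j => ?_)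
      have := hm j
      dsimp at this ⊢
      rw [fac, NatTrans.naturality_assoc, this]⟩

end CategoryTheory.Limits

namespace HomologicalComplex

variable {C ι J : Type*} [Category* C] [Category* J] [Abelian C] (c : ComplexShape ι)
  [HasColimitsOfShape J C] [HasExactColimitsOfShape J C]

/-- Opcycles are the cokernel of the incoming differential, and evaluation in a degree preserves
colimits. -/
instance (i : ι) : PreservesColimitsOfShape J (opcyclesFunctor C c i) := by
  let η : eval C c (c.prev i) ⟶ eval C c i := { app K := K.d _ _, naturality _ _ f := f.comm _ _ }
  let π : eval C c i ⟶ opcyclesFunctor C c i := 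
    { app K := K.pOpcycles i, naturality _ _ f := (p_opcyclesMap f i).symm }
  have : ∀ X, Epi (π.app X) := fun X => inferInstanceAs (Epi (X.pOpcycles i))
  exact preservesColimitsOfShape_of_cokernel η π (fun X => X.d_pOpcycles _ _)
    (fun X => ShortComplex.exact_of_g_is_cokernel _ (X.opcyclesIsCokernel _ _ rfl))

/-- Homology is the kernel of the map from opcycles to the next degree; exactness of the colimits
enters here. -/
instance (i : ι) : PreservesColimitsOfShape J (homologyFunctor C c i) := by
  let η : opcyclesFunctor C c i ⟶ eval C c (c.next i) := 
    { app K := K.fromOpcycles _ _, naturality X Y f := (by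
        change opcyclesMap f i ≫ Y.fromOpcycles i (c.next i) =
          X.fromOpcycles i (c.next i) ≫ f.f (c.next i)
        simp [← cancel_epi (X.pOpcycles i)]) }
  let κ : homologyFunctor C c i ⟶ opcyclesFunctor C c i := 
    { app K := K.homologyι i, naturality _ _ f := homologyι_naturality f i }
  have : ∀ X, Mono (κ.app X) := fun X => inferInstanceAs (Mono (X.homologyι i))
  exact preservesColimitsOfShape_of_kernel κ η (fun X => X.homologyι_comp_fromOpcycles _ _)
    (fun X => ShortComplex.exact_of_f_is_kernel _ (X.homologyIsKernel _ _ rfl))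

variable (C) in
instance quasiIso_isStableUnderColimitsOfShape :
    (quasiIso C c).IsStableUnderColimitsOfShape J where
  condition X₁ X₂ c₁ c₂ h₁ h₂ f hf φ hφ := by
    rw [mem_quasiIso_iff, quasiIso_iff]
    intro i
    rw [quasiIsoAt_iff_isIso_homologyMap]
    refine MorphismProperty.IsStableUnderColimitsOfShape.condition
      (W := MorphismProperty.isomorphisms C) _ _ _ _
      (isColimitOfPreserves (homologyFunctor C c i) h₁)
      (isColimitOfPreserves (homologyFunctor C c i) h₂)
      (Functor.whiskerRight f (homologyFunctor C c i)) (fun j => ?_) (homologyMap φ i)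
      (fun j => ?_)
    · have : QuasiIso (f.app j) := hf j
      exact inferInstanceAs (IsIso (homologyMap (f.app j) i))
    · exact ((homologyFunctor C c i).map_comp _ _).symm.trans
        ((congrArg _ (hφ j)).trans ((homologyFunctor C c i).map_comp _ _))

end HomologicalComplex

namespace CategoryTheory.ShortComplex.ShortExact

variable {C ι : Type*} [Category* C] [Abelian C] {c : ComplexShape ι}
  {S : ShortComplex (HomologicalComplex C c)}

lemma quasiIso_f (hS : S.ShortExact) (h : S.X₃.Acyclic) (hc : ∀ j, ∃ i, c.Rel i j):
    _root_.QuasiIso S.f := by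
  rw [_root_.quasiIso_iff]
  intro i
  rw [quasiIsoAt_iff_isIso_homologyMap]
  have h' (i : ι) := (HomologicalComplex.exactAt_iff_isZero_homology _ _).1 (h i)
  obtain ⟨k, hk⟩ := hc i
  have := (hS.homology_exact₁ k i hk).mono_g ((h' k).eq_of_src _ _)
  have := (hS.homology_exact₂ i).epi_f ((h' i).eq_of_tgt _ _)
  exact isIso_of_mono_of_epi _

lemma quasiIso_g (hS : S.ShortExact) (h : S.X₁.Acyclic) (hc : ∀ j, ∃ k, c.Rel j k):
    _root_.QuasiIso S.g := by
  rw [_root_.quasiIso_iff]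
  intro i
  rw [quasiIsoAt_iff_isIso_homologyMap]
  have h' (i : ι) := (HomologicalComplex.exactAt_iff_isZero_homology _ _).1 (h i)
  obtain ⟨k, hk⟩ := hc i
  have := (hS.homology_exact₂ i).mono_g ((h' i).eq_of_src _ _)
  have := (hS.homology_exact₃ i k hk).epi_f ((h' k).eq_of_tgt _ _)
  exact isIso_of_mono_of_epi _

end CategoryTheory.ShortComplex.ShortExact

namespace CochainComplex

variable (C : Type*) [Category* C] [Abelian C]

/-- The class of monomorphisms of complexes that are quasi-isomorphisms. -/
def acyclicMono : MorphismProperty (CochainComplex C ℤ) :=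
  MorphismProperty.monomorphisms _ ⊓ HomologicalComplex.quasiIso C (ComplexShape.up ℤ)

variable {C}

lemma quasiIso_iff_acyclic_cokernel {K L : CochainComplex C ℤ} (f : K ⟶ L) [Mono f] :
    QuasiIso f ↔ (cokernel f).Acyclic := by
  have hS : (ShortComplex.mk f (cokernel.π f) (by simp)).ShortExact :=
    { exact := ShortComplex.exact_of_g_is_cokernel _ (cokernelIsCokernel f) }
  exact ⟨fun h => hS.acyclic_X₃ h, fun h => hS.quasiIso_f h (fun j => ⟨j - 1, by simp⟩)⟩

/-- A pushout leaves the cokernel unchanged, and acyclicity of the cokernel characterizes these maps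
among monomorphisms. -/
instance : (acyclicMono C).IsStableUnderCobaseChange where
  of_isPushout {X Y X' Y' f g f' g'} sq hf := by
    have : Mono f := hf.1
    have : Mono f' := (MorphismProperty.monomorphisms _).of_isPushout sq hf.1
    refine ⟨this, (quasiIso_iff_acyclic_cokernel f').2 ?_⟩
    have := isIso_cokernel_map_of_isPushout sq.flip
    exact fun i => (exactAt_iff_of_quasiIsoAt (cokernel.map _ _ _ _ sq.flip.w) i).1
      ((quasiIso_iff_acyclic_cokernel f).1 hf.2 i)

instance : (acyclicMono C).IsMultiplicative := by unfold acyclicMono; infer_instance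
instance : (acyclicMono C).IsStableUnderRetracts := by unfold acyclicMono; infer_instance
instance : (acyclicMono C).RespectsIso := by unfold acyclicMono; infer_instance

instance (J : Type*) [Category* J] [HasColimitsOfShape J C] [HasExactColimitsOfShape J C] :
    (acyclicMono C).IsStableUnderColimitsOfShape J where
  condition X₁ X₂ c₁ c₂ h₁ h₂ f hf φ hφ :=
    ⟨MorphismProperty.IsStableUnderColimitsOfShape.condition X₁ X₂ c₁ c₂ h₁ h₂ f
      (fun j => (hf j).1) φ hφ,
     MorphismProperty.IsStableUnderColimitsOfShape.condition X₁ X₂ c₁ c₂ h₁ h₂ f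
      (fun j => (hf j).2) φ hφ⟩

variable {C : Type u} [Category.{v} C] [Abelian C] [IsGrothendieckAbelian.{v} C] 

instance : MorphismProperty.IsStableUnderTransfiniteComposition.{v} (acyclicMono C) := by
  have : MorphismProperty.IsStableUnderFilteredColimits.{v, v} (acyclicMono C) := ⟨by
    intro J _ _; infer_instance⟩
  infer_instance

instance : MorphismProperty.IsStableUnderCoproducts.{v} (acyclicMono C) where

end CochainComplex

end

/-! ### Subobjects generated by few maps from a separator. -/

noncomputable section

namespace CategoryTheory.Subobject

variable {C : Type u} [Category.{v} C]

lemma imageSubobject_le_iff [Abelian C] {X Y : C} (f : X ⟶ Y) (A : Subobject Y) :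
    imageSubobject f ≤ A ↔ A.Factors f := by
  refine ⟨fun h => factors_of_le f h ?_, fun h => imageSubobject_le f (A.factorThru f h) (by simp)⟩
  simpa using imageSubobject_factors_comp_self f (𝟙 X)

lemma factors_sigmaDesc_iff {ι : Type*} {X : ι → C} [HasCoproduct X] {Y : C} (f : ∀ i, X i ⟶ Y)
    (A : Subobject Y) : A.Factors (Limits.Sigma.desc f) ↔ ∀ i, A.Factors (f i) := by
  refine ⟨fun h i => ?_, fun h => ?_⟩
  · simpa using factors_of_factors_right (Limits.Sigma.ι X i) h
  · have : Limits.Sigma.desc f =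
        Limits.Sigma.desc (fun i => A.factorThru (f i) (h i)) ≫ A.arrow :=
      Limits.Sigma.hom_ext _ _ (fun i => by simp)
    rw [this]
    exact factors_comp_arrow _

variable [Abelian C]

lemma factors_coprodDesc_iff {X X' Y : C} (f : X ⟶ Y) (f' : X' ⟶ Y)
    (A : Subobject Y) : A.Factors (coprod.desc f f') ↔ A.Factors f ∧ A.Factors f' := by
  refine ⟨fun h => ⟨?_, ?_⟩, fun h => ?_⟩
  · have := factors_of_factors_right coprod.inl h
    rwa [coprod.inl_desc] at this
  · have := factors_of_factors_right coprod.inr h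
    rwa [coprod.inr_desc] at this
  · have : coprod.desc f f' = coprod.desc (A.factorThru f h.1) (A.factorThru f' h.2) ≫ A.arrow := by
      ext <;> simp
    rw [this]
    exact factors_comp_arrow _

/-- A subobject containing the images of all maps from a separator along an epimorphism is the
whole object. -/
lemma eq_top_of_factors_comp_of_isSeparator {U Y Z : C} (hU : IsSeparator U) (p : Y ⟶ Z) [Epi p]
    (A : Subobject Z) (h : ∀ s : U ⟶ Y, A.Factors (s ≫ p)) : A = ⊤ := by
  have h' : p ≫ cokernel.π A.arrow = 0 := hU.def _ _ (fun s => by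
    rw [comp_zero, ← Category.assoc, ← A.factorThru_arrow _ (h s), Category.assoc,
      cokernel.condition, comp_zero])
  have : Epi A.arrow := Preadditive.epi_of_cokernel_zero (by
    rw [← cancel_epi p, h', comp_zero])
  rw [← isIso_arrow_iff_eq_top]
  exact isIso_of_mono_of_epi _

section

variable {J : Type*} [Preorder J] {Z : C} (T : J →o Subobject Z)

/-- The diagram of the subobjects in a monotone family. -/
@[simps]
def familyFunctor : J ⥤ C where
  obj j := (T j : C)
  map φ := ofLE _ _ (T.monotone (leOfHom φ))

instance {j j' : J} (φ : j ⟶ j') : Mono ((familyFunctor T).map φ) :=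
  inferInstanceAs (Mono (ofLE _ _ _))

/-- The cocone given by factorizations through `b : B ⟶ Z` of the inclusions of the subobjects in
a monotone family. -/
@[simps]
def familyCocone {B : C} (b : B ⟶ Z) [Mono b] (φ : ∀ j, (T j : C) ⟶ B)
    (hφ : ∀ j, φ j ≫ b = (T j).arrow) : Cocone (familyFunctor T) where
  pt := B
  ι :=
    { app := φ
      naturality j j' f := by
        rw [← cancel_mono b]
        change (ofLE _ _ _ ≫ φ j') ≫ b = (φ j ≫ 𝟙 B) ≫ b
        rw [Category.comp_id, Category.assoc, hφ, hφ, ofLE_arrow] }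

end

/-- A filtered family of subobjects is a colimit diagram over its supremum. -/
def isColimitFamilyCocone [IsGrothendieckAbelian.{v} C] {J : Type v} [Preorder J] [IsFiltered J]
    {Z : C} (T : J →o Subobject Z) {B : C} (b : B ⟶ Z) [Mono b] (φ : ∀ j, (T j : C) ⟶ B)
    (hφ : ∀ j, φ j ≫ b = (T j).arrow) (hT : Subobject.mk b = ⨆ j, T j) :
    IsColimit (familyCocone T b φ hφ) := by
  let F : J ⥤ MonoOver Z :=
    { obj j := MonoOver.mk (T j).arrow
      map φ := MonoOver.homMk (ofLE _ _ (T.monotone (leOfHom φ))) }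
  let c : Cocone (F ⋙ MonoOver.forget _) :=
    { pt := Over.mk b
      ι :=
        { app j := Over.homMk (φ j) (hφ j)
          naturality _ _ f := Over.OverMorphism.ext ((familyCocone T b φ hφ).ι.naturality f) } }
  have : Mono c.pt.hom := inferInstanceAs (Mono b)
  exact IsGrothendieckAbelian.isColimitMapCoconeOfSubobjectMkEqISup F c (by
    have h (j : J) : Subobject.mk (F.obj j).obj.hom = T j := Subobject.mk_arrow _
    simp_rw [h]
    exact hT)

end CategoryTheory.Subobject

/-- The subsets of cardinality smaller than `κ` of a type. -/
abbrev SmallSubset (κ : Cardinal.{v}) (X : Type v) : Type v := {S : Set X // HasCardinalLT S κ}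

namespace SmallSubset

instance (κ : Cardinal.{v}) [Fact κ.IsRegular] (X : Type v) :
    IsCardinalFiltered (SmallSubset κ X) κ :=
  isCardinalFiltered_preorder _ _ (fun _ s hK =>
    ⟨⟨⋃ k, (s k).1, hasCardinalLT_iUnion _ ((hasCardinalLT_iff_cardinal_mk_lt _ _).2 hK)
      (fun k => (s k).2)⟩, fun k => Set.subset_iUnion (fun k => (s k).1) k⟩)

instance (κ : Cardinal.{v}) [Fact κ.IsRegular] (X : Type v) : IsFiltered (SmallSubset κ X) :=
  isFiltered_of_isCardinalFiltered _ κ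

/-- The subset with one element. -/
def singleton (κ : Cardinal.{v}) [Fact κ.IsRegular] {X : Type v} (x : X) : SmallSubset κ X :=
  ⟨{x}, hasCardinalLT_of_finite _ _ (Cardinal.IsRegular.aleph0_le Fact.out)⟩

/-- The empty subset. -/
def empty (κ : Cardinal.{v}) [Fact κ.IsRegular] {X : Type v} : SmallSubset κ X :=
  ⟨∅, hasCardinalLT_of_finite _ _ (Cardinal.IsRegular.aleph0_le Fact.out)⟩

open Classical in
/-- Any small subset of a pointed type is, up to the point, the range of a map from `κ`. -/
lemma exists_enumeration {κ : Cardinal.{v}} {X : Type v} (S : SmallSubset κ X) (x : X) :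
    ∃ f : κ.ord.ToType → X, S.1 ⊆ Set.range f ∧ Set.range f ⊆ insert x S.1 := by
  have h : Cardinal.mk S.1 ≤ Cardinal.mk κ.ord.ToType := by
    simpa using ((hasCardinalLT_iff_cardinal_mk_lt _ _).1 S.2).le
  obtain ⟨i⟩ := h
  refine ⟨fun t => if h : ∃ s, i s = t then h.choose.1 else x, fun s hs => ⟨i ⟨s, hs⟩, ?_⟩, ?_⟩
  · have h : ∃ s', i s' = i ⟨s, hs⟩ := ⟨_, rfl⟩
    dsimp only
    rw [dif_pos h, i.injective h.choose_spec]
  · rintro _ ⟨t, rfl⟩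
    dsimp
    split_ifs with h
    · exact Or.inr h.choose.2
    · exact Or.inl rfl

end SmallSubset
end

/-! ### Acyclic subcomplexes of bounded size. -/

noncomputable section

namespace CategoryTheory.Subobject

/-- Indexes the quotients of `N` by its subobjects, so that up to isomorphism they form a small set.
-/
lemma exists_iso_cokernel_arrow {C : Type u} [Category.{v} C] [Abelian C] {N Q : C} (q : N ⟶ Q)
    [Epi q] : ∃ K : Subobject N, Nonempty (cokernel K.arrow ≅ Q) := by
  let K : Subobject N := Subobject.mk (kernel.ι q)
  have w : K.arrow ≫ q = 0 := by
    rw [← Subobject.underlyingIso_hom_comp_eq_mk, Category.assoc, kernel.condition, comp_zero]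
  let k : IsLimit (KernelFork.ofι K.arrow w) := IsLimit.ofIsoLimit (kernelIsKernel q)
    (Fork.ext (Subobject.underlyingIso _).symm (by simp [K]))
  exact ⟨K, ⟨IsColimit.coconePointUniqueUpToIso (cokernelIsCokernel K.arrow)
    (Abelian.epiIsCokernelOfKernel _ k)⟩⟩

variable {C : Type u} [Category.{v} C] [Abelian C] [IsGrothendieckAbelian.{v} C]

/-- The family of subobjects of `Z` obtained by adding to a subobject `Z₀` the images
of a varying small set of maps. -/
def generatedFamily (κ : Cardinal.{v}) {U Y Z : C} (p : Y ⟶ Z) (Z₀ : Subobject Z) :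
    SmallSubset κ (U ⟶ Y) →o Subobject Z where
  toFun S := Z₀ ⊔ ⨆ s ∈ S.1, imageSubobject (s ≫ p)
  monotone' _ _ h := sup_le_sup_left (biSup_mono h) _

lemma generatedFamily_le_iff (κ : Cardinal.{v}) {U Y Z : C} (p : Y ⟶ Z) (Z₀ : Subobject Z)
    (S : SmallSubset κ (U ⟶ Y)) (A : Subobject Z) :
    generatedFamily κ p Z₀ S ≤ A ↔ Z₀ ≤ A ∧ ∀ s ∈ S.1, A.Factors (s ≫ p) := by
  change Z₀ ⊔ ⨆ s ∈ S.1, imageSubobject (s ≫ p) ≤ A ↔ _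
  simp [imageSubobject_le_iff]

lemma iSup_generatedFamily (κ : Cardinal.{v}) [Fact κ.IsRegular] {U Y Z : C}
    (hU : IsSeparator U) (p : Y ⟶ Z) [Epi p] (Z₀ : Subobject Z) :
    ⨆ S : SmallSubset κ (U ⟶ Y), generatedFamily κ p Z₀ S = ⊤ := by
  refine eq_top_of_factors_comp_of_isSeparator hU p _ (fun s => ?_)
  rw [← imageSubobject_le_iff]
  refine le_trans ?_ (le_iSup _ (SmallSubset.singleton κ s))
  rw [imageSubobject_le_iff]
  exact ((generatedFamily_le_iff κ p Z₀ _ _).1 le_rfl).2 s rfl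

/-- A member of `generatedFamily` is the image of a map from a coproduct. -/
lemma exists_sigmaDesc_eq_generatedFamily {κ : Cardinal.{v}} {U N Y Z : C} (p : Y ⟶ Z)
    (f : N ⟶ Y) (S : SmallSubset κ (U ⟶ Y)) :
    ∃ e : (∐ fun _ : κ.ord.ToType => U) ⟶ Y,
      imageSubobject (coprod.desc f e ≫ p) = generatedFamily κ p (imageSubobject (f ≫ p)) S := by
  -- Superfluous indices carry the zero map, which adds nothing to the image; thus one coproduct
  -- serves for all small sets of maps.
  obtain ⟨t, ht, ht'⟩ := S.exists_enumeration 0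
  refine ⟨Limits.Sigma.desc t, eq_of_forall_ge_iff (fun A => ?_)⟩
  have h : Limits.Sigma.desc t ≫ p = Limits.Sigma.desc (fun i => t i ≫ p) :=
    Limits.Sigma.hom_ext _ _ (fun i => by simp)
  have h' : coprod.desc f (Limits.Sigma.desc t) ≫ p =
      coprod.desc (f ≫ p) (Limits.Sigma.desc (fun i => t i ≫ p)) := by
    rw [← h, coprod.desc_comp]
  rw [h', imageSubobject_le_iff, factors_coprodDesc_iff, factors_sigmaDesc_iff,
    generatedFamily_le_iff, imageSubobject_le_iff]
  refine and_congr_right (fun _ => ⟨fun h s hs => ?_, fun h i => ?_⟩)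
  · obtain ⟨i, rfl⟩ := ht hs
    exact h i
  · obtain hi | hi := ht' ⟨i, rfl⟩
    · rw [hi, zero_comp]
      exact factors_zero
    · exact h _ hi

end CategoryTheory.Subobject

namespace CochainComplex

open CategoryTheory.Subobject HomologicalComplex

variable {A : Type u} [Category.{v} A] [Abelian A] [IsGrothendieckAbelian.{v} A]

/-- `N` has only a small set of quotients, so a single `κ` bounds the homology of all of them. The
condition on `ℤ` allows a common upper bound over all degrees. -/
lemma exists_cardinal_subobject_homology (N : CochainComplex A ℤ) :
    ∃ (κ : Cardinal.{v}), κ.IsRegular ∧ HasCardinalLT ℤ κ ∧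
      ∀ (Q : CochainComplex A ℤ) (q : N ⟶ Q) [Epi q] (m : ℤ),
        HasCardinalLT (Subobject (Q.homology m)) κ := by
  obtain ⟨κ, hκ, h⟩ := HasCardinalLT.exists_regular_cardinal_forall.{v}
    (fun x : Subobject N × ℤ => Subobject ((cokernel x.1.arrow).homology x.2) ⊕ ℤ)
  refine ⟨κ, hκ, (h (⊤, 0)).of_injective _ Sum.inr_injective, fun Q q _ m => ?_⟩
  obtain ⟨K, ⟨e⟩⟩ := exists_iso_cokernel_arrow q
  exact Subobject.hasCardinalLT_of_mono
    ((h (K, m)).of_injective _ Sum.inl_injective) (homologyMap e.inv m)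

/-- Any complex `N` maps to a complex `N'` such that the image of `N` in an acyclic quotient of
a complex `Y` becomes trivial on homology in the image of `N'`. -/
lemma exists_homologyMap_ofLE_eq_zero {U : CochainComplex A ℤ} (hU : IsSeparator U)
    (N : CochainComplex A ℤ) :
    ∃ N' : CochainComplex A ℤ, ∀ ⦃Y Z : CochainComplex A ℤ⦄ (p : Y ⟶ Z) [Epi p], Z.Acyclic →
      ∀ f : N ⟶ Y, ∃ (f' : N' ⟶ Y) (h : imageSubobject (f ≫ p) ≤ imageSubobject (f' ≫ p)),
        ∀ m, homologyMap (ofLE _ _ h) m = 0 := by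
  obtain ⟨κ, hκ, hℤ, h⟩ := exists_cardinal_subobject_homology N
  have : Fact κ.IsRegular := ⟨hκ⟩
  refine ⟨N ⨿ ∐ fun _ : κ.ord.ToType => U, fun Y Z p _ hZ f => ?_⟩
  let T : SmallSubset κ (U ⟶ Y) →o Subobject Z := generatedFamily κ p (imageSubobject (f ≫ p))
  have hc := isColimitFamilyCocone T (𝟙 Z) (fun S => (T S).arrow) (fun _ => Category.comp_id _)
    (((isIso_iff_mk_eq_top (𝟙 Z)).1 inferInstance).trans (iSup_generatedFamily κ hU p _).symm)
  have le (S) : imageSubobject (f ≫ p) ≤ T S :=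
    ((generatedFamily_le_iff κ p _ S _).1 le_rfl).1
  have (m : ℤ) : ∃ S, homologyMap (ofLE _ _ (le S)) m = 0 := by
    -- The homology of `Z` vanishes and is the colimit of the homologies of the `T S`. The homology
    -- of the image of `N` has fewer than `κ` subobjects, so it already dies at some `S`.
    obtain ⟨S, φ, hS⟩ := IsGrothendieckAbelian.IsPresentable.injectivity₀
      (isColimitOfPreserves (homologyFunctor A (ComplexShape.up ℤ) m) hc)
      (h (imageSubobject (f ≫ p)) (factorThruImageSubobject (f ≫ p)) m)
      (j₀ := SmallSubset.empty κ) (homologyMap (ofLE _ _ (le _)) m)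
      (((exactAt_iff_isZero_homology _ _).1 (hZ m)).eq_of_tgt _ _)
    refine ⟨S, Eq.trans ?_ hS⟩
    refine Eq.trans ?_ (homologyMap_comp _ _ _)
    congr 1
    exact (ofLE_comp_ofLE _ _ _ (le _) (T.monotone (leOfHom φ))).symm
  choose S hS using this
  let S' := IsCardinalFiltered.max S hℤ
  obtain ⟨e, he⟩ := exists_sigmaDesc_eq_generatedFamily (κ := κ) p f S'
  have le' (m : ℤ) : T (S m) ≤ imageSubobject (coprod.desc f e ≫ p) := by
    rw [he]
    exact T.monotone (leOfHom (IsCardinalFiltered.toMax S hℤ m))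
  refine ⟨coprod.desc f e, (le _).trans (le' 0), fun m => ?_⟩
  rw [← ofLE_comp_ofLE _ _ _ (le (S m)) (le' m), homologyMap_comp, hS, zero_comp]

/-- Iterating `exists_homologyMap_ofLE_eq_zero` from `U` gives an increasing sequence of
subcomplexes whose transition maps vanish on homology, so their union is acyclic. The coproduct `V`
of the stages depends only on `U`. -/
lemma exists_acyclic_imageSubobject {U : CochainComplex A ℤ} (hU : IsSeparator U) :
    ∃ V : CochainComplex A ℤ, ∀ ⦃Y Z : CochainComplex A ℤ⦄ (p : Y ⟶ Z) [Epi p], Z.Acyclic →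
      ∀ f₀ : U ⟶ Y, ∃ f : V ⟶ Y, (imageSubobject (f ≫ p)).Factors (f₀ ≫ p) ∧
        HomologicalComplex.Acyclic (imageSubobject (f ≫ p) : CochainComplex A ℤ) := by
  choose next hnext using exists_homologyMap_ofLE_eq_zero hU
  let N (n : ℕ) : CochainComplex A ℤ :=
    Nat.rec (motive := fun _ => CochainComplex A ℤ) U (fun _ => next) n
  refine ⟨∐ fun n : ULift.{v} ℕ => N n.down, fun Y Z p _ hZ f₀ => ?_⟩
  choose g hg₁ hg₂ using fun n => hnext (N n) p hZ
  let f (n : ℕ) : N n ⟶ Y :=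
    Nat.rec (motive := fun n => N n ⟶ Y) f₀ (fun n f => g n f) n
  let t (n : ℕ) : Subobject Z := imageSubobject (f n ≫ p)
  have ht : Monotone t := monotone_nat_of_le_succ (fun n => hg₁ n (f n))
  let T : ULift.{v} ℕ →o Subobject Z := ⟨fun n => t n.down, fun _ _ h => ht h⟩
  let F : (∐ fun n : ULift.{v} ℕ => N n.down) ⟶ Y := Limits.Sigma.desc (fun n => f n.down)
  have hF : imageSubobject (F ≫ p) = ⨆ n, T n := eq_of_forall_ge_iff (fun B => by
    have h : F ≫ p = Limits.Sigma.desc (fun n : ULift.{v} ℕ => f n.down ≫ p) :=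
      Limits.Sigma.hom_ext _ _ (fun i => by simp [F])
    rw [h, imageSubobject_le_iff, factors_sigmaDesc_iff, iSup_le_iff]
    exact forall_congr' (fun n => (imageSubobject_le_iff _ _).symm))
  have le (n) : T n ≤ imageSubobject (F ≫ p) := by rw [hF]; exact le_iSup _ _
  refine ⟨F, (imageSubobject_le_iff _ _).1 (le ⟨0⟩), fun m => ?_⟩
  rw [exactAt_iff_isZero_homology]
  have hc := isColimitOfPreserves (homologyFunctor A (ComplexShape.up ℤ) m)
    (isColimitFamilyCocone T (imageSubobject (F ≫ p)).arrow (fun n => ofLE _ _ (le n))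
      (fun n => ofLE_arrow _) ((Subobject.mk_arrow _).trans hF))
  rw [IsZero.iff_id_eq_zero]
  refine hc.hom_ext (fun n => ?_)
  have h : homologyMap (ofLE _ _ (le n)) m = 0 := by
    rw [← ofLE_comp_ofLE _ _ _ (T.monotone (show n ≤ ⟨n.down + 1⟩ from Nat.le_succ n.down))
      (le ⟨n.down + 1⟩), homologyMap_comp]
    refine Eq.trans (congrArg (· ≫ _) (hg₂ n.down (f n.down) m)) zero_comp
  exact ((Category.comp_id _).trans h).trans comp_zero.symm

end CochainComplex
end

/-! ### A small set that generates the acyclic monomorphisms. -/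

noncomputable section

namespace CochainComplex

open CategoryTheory.Subobject HomologicalComplex MorphismProperty

section

variable {A : Type u} [Category.{v} A] [Abelian A]

/-- The inclusions of the subcomplexes of `V` that are quasi-isomorphisms. -/
def generatingAcyclicMono (V : CochainComplex A ℤ) : MorphismProperty (CochainComplex A ℤ) :=
  ofHoms (fun X : {X : Subobject V // QuasiIso X.arrow} ↦ X.1.arrow)

lemma generatingAcyclicMono_arrow {V : CochainComplex A ℤ} (X : Subobject V)
    (hX : QuasiIso X.arrow) : generatingAcyclicMono V X.arrow :=
  ofHoms.mk (f := fun X : {X : Subobject V // QuasiIso X.arrow} ↦ X.1.arrow) ⟨X, hX⟩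

lemma generatingAcyclicMono_le (V : CochainComplex A ℤ) :
    generatingAcyclicMono V ≤ acyclicMono A := by
  rintro _ _ _ ⟨X⟩
  exact ⟨inferInstanceAs (Mono X.1.arrow), X.2⟩

/-- The complex `V` detects acyclic subcomplexes: the existence of such a complex implies that
`generatingAcyclicMono V` generates all monomorphisms that are quasi-isomorphisms. -/
def DetectsAcyclic (V : CochainComplex A ℤ) : Prop :=
  ∀ ⦃Y Z : CochainComplex A ℤ⦄ (p : Y ⟶ Z) [Epi p], Z.Acyclic → p ≠ 0 →
    ∃ f : V ⟶ Y, f ≫ p ≠ 0 ∧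
      HomologicalComplex.Acyclic (imageSubobject (f ≫ p) : CochainComplex A ℤ)

lemma exists_detectsAcyclic [IsGrothendieckAbelian.{v} A] :
    ∃ V : CochainComplex A ℤ, DetectsAcyclic V := by
  have hU := isSeparator_separator (CochainComplex A ℤ)
  obtain ⟨V, hV⟩ := exists_acyclic_imageSubobject hU
  refine ⟨V, fun Y Z p _ hZ hp => ?_⟩
  obtain ⟨f₀, hf₀⟩ : ∃ f₀, f₀ ≫ p ≠ 0 := by
    by_contra! h
    exact hp (hU.def _ _ (fun s => (h s).trans comp_zero.symm))
  obtain ⟨f, hf, hf'⟩ := hV p hZ f₀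
  refine ⟨f, fun h => hf₀ ?_, hf'⟩
  rwa [h, imageSubobject_zero, bot_factors_iff_zero] at hf

namespace generatingAcyclicMono

variable {V : CochainComplex A ℤ}

/-- Take `f : V ⟶ Y` with nonzero acyclic image in the cokernel of `p`. The pullback of `p` along
`f` is the kernel of the map from `V` onto this image, hence a generator up to isomorphism. Its
pushout is the sum of `X` and the image of `f` inside `Y`. -/
lemma exists_pushouts (hV : DetectsAcyclic V) {X Y : CochainComplex A ℤ} (p : X ⟶ Y)
    (hp : acyclicMono A p) (hp' : ¬ IsIso p) :
    ∃ (X' : CochainComplex A ℤ) (i : X ⟶ X') (p' : X' ⟶ Y)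
      (_ : (generatingAcyclicMono V).pushouts i) (_ : ¬ IsIso i) (_ : Mono p'), i ≫ p' = p := by
  have : Mono p := hp.1
  have hπ : cokernel.π p ≠ 0 := fun h => hp' (by
    have := Preadditive.epi_of_cokernel_zero h
    exact isIso_of_mono_of_epi _)
  obtain ⟨f, hf, hf'⟩ := hV (cokernel.π p) ((quasiIso_iff_acyclic_cokernel p).1 hp.2) hπ
  have w : pullback.snd p f ≫ factorThruImageSubobject (f ≫ cokernel.π p) = 0 := by
    rw [← cancel_mono (imageSubobject _).arrow, zero_comp, Category.assoc,
      imageSubobject_arrow_comp, ← pullback.condition_assoc, cokernel.condition, comp_zero]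
  have hS : (ShortComplex.mk _ _ w).ShortExact :=
    { exact := ShortComplex.exact_of_f_is_kernel _
        (KernelFork.IsLimit.ofι' _ _ (fun k hk => by
          have hk' : (k ≫ f) ≫ cokernel.π p = 0 := by
            have := hk =≫ (imageSubobject _).arrow
            rwa [Category.assoc, imageSubobject_arrow_comp, zero_comp, ← Category.assoc] at this
          exact ⟨pullback.lift (Abelian.monoLift p _ hk') k (Abelian.monoLift_comp _ _ _),
            pullback.lift_snd _ _ _⟩)) }
  have hq : QuasiIso (pullback.snd p f) := hS.quasiIso_f hf' (fun j => ⟨j - 1, by simp⟩)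
  have hq' : QuasiIso (Subobject.mk (pullback.snd p f)).arrow := by
    rw [← Subobject.underlyingIso_hom_comp_eq_mk]
    infer_instance
  refine ⟨pushout (pullback.fst p f) (pullback.snd p f), pushout.inl _ _,
    pushout.desc p f pullback.condition,
    ⟨_, _, _, (Subobject.underlyingIso _).hom ≫ pullback.fst _ _,
    pushout.inr _ _, generatingAcyclicMono_arrow _ hq',
    (IsPushout.of_hasPushout (pullback.fst p f) (pullback.snd p f)).of_iso
      ((Subobject.underlyingIso _).symm) (Iso.refl _) (Iso.refl _)
      (Iso.refl _)
      (by rw [Iso.refl_hom, Category.comp_id, Iso.symm_hom, Iso.inv_hom_id_assoc])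
      (by rw [Iso.refl_hom, Category.comp_id, Iso.symm_hom, ← Subobject.underlyingIso_hom_comp_eq_mk,
        Iso.inv_hom_id_assoc])
      (by rw [Iso.refl_hom, Category.comp_id, Iso.refl_hom, Category.id_comp])
      (by rw [Iso.refl_hom, Category.comp_id, Iso.refl_hom, Category.id_comp])⟩, fun h => hf ?_, ?_,
    by rw [pushout.inl_desc]⟩
  -- If nothing had been added, `f` would factor through `p` and vanish in the cokernel.
  · have : f = (pushout.inr (pullback.fst p f) (pullback.snd p f) ≫
        inv (pushout.inl (pullback.fst p f) (pullback.snd p f))) ≫ p := by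
      have hp₂ : inv (pushout.inl (pullback.fst p f) (pullback.snd p f)) ≫ p =
          pushout.desc p f pullback.condition := by
        rw [IsIso.inv_comp_eq, pushout.inl_desc]
      rw [Category.assoc, hp₂, pushout.inr_desc]
    rw [this, Category.assoc, cokernel.condition, comp_zero]
  · exact (IsPushout.of_hasPushout _ _).mono_of_isPullback_of_mono
      (IsPullback.of_hasPullback p f) _ (pushout.inl_desc _ _ _) (pushout.inr_desc _ _ _)

lemma exists_larger_subobject (hV : DetectsAcyclic V) {X : CochainComplex A ℤ} (B : Subobject X)
    (hB : QuasiIso B.arrow) (hB' : B ≠ ⊤) :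
    ∃ (B' : Subobject X) (h : B < B'),
      (generatingAcyclicMono V).pushouts (Subobject.ofLE B B' h.le) := by
  obtain ⟨X', i, p', hi, hi', hp', fac⟩ := exists_pushouts hV B.arrow
    ⟨inferInstanceAs (Mono B.arrow), hB⟩ (by simpa only [Subobject.isIso_arrow_iff_eq_top] using hB')
  have lt : B < Subobject.mk p' := by
    conv_lhs => rw [← Subobject.mk_arrow B]
    exact Subobject.mk_lt_mk_of_comm i fac hi'
  refine ⟨Subobject.mk p', lt, (MorphismProperty.arrow_mk_iso_iff _ ?_).2 hi⟩
  refine Arrow.isoMk (Iso.refl _) (Subobject.underlyingIso p') ?_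
  simp [← cancel_mono p', fac]

variable (hV : DetectsAcyclic V)

open scoped Classical in
/-- A subobject larger than a given one (if possible): if the inclusion of `B` is
a quasi-isomorphism, then that of `B` in the larger subobject is a pushout of a map
in `generatingAcyclicMono V`. -/
def largerSubobject {X : CochainComplex A ℤ} (B : Subobject X) : Subobject X :=
  if hB : QuasiIso B.arrow ∧ B ≠ ⊤ then (exists_larger_subobject hV B hB.1 hB.2).choose else ⊤

variable {X : CochainComplex A ℤ}

variable (X) in
@[simp]
lemma largerSubobject_top : largerSubobject hV (⊤ : Subobject X) = ⊤ := dif_neg (by simp)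

lemma lt_largerSubobject (B : Subobject X) (hB : B ≠ ⊤) : B < largerSubobject hV B := by
  dsimp only [largerSubobject]
  split_ifs with h
  · exact (exists_larger_subobject hV B h.1 h.2).choose_spec.choose
  · exact hB.lt_top

lemma le_largerSubobject (B : Subobject X) : B ≤ largerSubobject hV B := by
  by_cases hB : B = ⊤
  · subst hB
    simp only [largerSubobject_top, le_refl]
  · exact (lt_largerSubobject hV B hB).le

lemma pushouts_ofLE_le_largerSubobject (B : Subobject X) (hB : QuasiIso B.arrow) :
    (generatingAcyclicMono V).pushouts (Subobject.ofLE _ _ (le_largerSubobject hV B)) := by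
  by_cases hB' : B = ⊤
  · subst hB'
    have := (Subobject.isIso_arrow_iff_eq_top (largerSubobject hV (⊤ : Subobject X))).2 (by simp)
    -- The class of generators contains the isomorphism `⊤.arrow`; every isomorphism is a pushout of
    -- it along a zero map.
    have h0 : QuasiIso (⊤ : Subobject V).arrow := inferInstance
    refine MorphismProperty.isomorphisms_le_pushouts _
      (fun _ ↦ ⟨_, _, _, generatingAcyclicMono_arrow _ h0, 0, inferInstance⟩) _ ?_
    have : IsIso ((⊤ : Subobject X).ofLE _ (le_largerSubobject hV ⊤) ≫
      (largerSubobject hV (⊤ : Subobject X)).arrow) := by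
        rw [Subobject.ofLE_arrow]; infer_instance
    exact IsIso.of_isIso_comp_right _ (largerSubobject hV (⊤ : Subobject X)).arrow
  · have h : QuasiIso B.arrow ∧ B ≠ ⊤ := ⟨hB, hB'⟩
    refine (MorphismProperty.arrow_mk_iso_iff _ ?_).1
      (exists_larger_subobject hV B h.1 h.2).choose_spec.choose_spec
    exact Arrow.isoMk (Iso.refl _)
      (Subobject.isoOfEq _ _ ((by simp [largerSubobject, dif_pos h]))) (by simp)

lemma quasiIso_largerSubobject_arrow (B : Subobject X) (hB : QuasiIso B.arrow) :
    QuasiIso (largerSubobject hV B).arrow := by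
  have h : acyclicMono A (Subobject.ofLE _ _ (le_largerSubobject hV B)) :=
    (MorphismProperty.pushouts_le_iff.2 (generatingAcyclicMono_le V)) _
      (pushouts_ofLE_le_largerSubobject hV B hB)
  have := h.2
  rw [mem_quasiIso_iff] at this
  rw [← Subobject.ofLE_arrow (le_largerSubobject hV B)] at hB
  exact quasiIso_of_comp_left (Subobject.ofLE _ _ (le_largerSubobject hV B)) _

variable [IsGrothendieckAbelian.{v} A]

/-- The iteration increases strictly until it reaches `⊤`, and a well-order of larger cardinality
than the set of subobjects cannot inject into it. -/
lemma exists_ordinal (A₀ : Subobject X) :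
    ∃ (o : Ordinal.{v}) (j : o.ToType), transfiniteIterate (largerSubobject hV) j A₀ = ⊤ := by
  let κ := Order.succ (Cardinal.mk (Shrink.{v} (Subobject X)))
  have : Nonempty κ.ord.ToType := by simp [κ]
  have := WellFoundedLT.toOrderBot κ.ord.ToType
  have hJ : HasCardinalLT (Subobject X) (Cardinal.mk κ.ord.ToType) :=
    lt_of_lt_of_le (Order.lt_succ _) (by simp [κ])
  exact ⟨κ.ord, top_mem_range_transfiniteIterate (largerSubobject hV) A₀ (lt_largerSubobject hV)
    (by simp) (fun h ↦ by simpa [hasCardinalLT_iff_cardinal_mk_lt] using hJ.of_injective _ h)⟩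

section

variable (A₀ : Subobject X) (J : Type v) [LinearOrder J] [OrderBot J] [SuccOrder J]
  [WellFoundedLT J]

/-- The transfinite iteration of `largerSubobject`, as a diagram of monomorphisms to `X`. -/
@[simps]
def functorToMonoOver : J ⥤ MonoOver X where
  obj j := MonoOver.mk (transfiniteIterate (largerSubobject hV) j A₀).arrow
  map {j j'} f := MonoOver.homMk (Subobject.ofLE _ _
      (monotone_transfiniteIterate _ _ (le_largerSubobject hV) (leOfHom f)))

/-- The transfinite iteration of `largerSubobject`, as a diagram of complexes. -/
abbrev functor : J ⥤ CochainComplex A ℤ :=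
  functorToMonoOver hV A₀ J ⋙ MonoOver.forget _ ⋙ Over.forget _

lemma quasiIso_transfiniteIterate_arrow (hA₀ : QuasiIso A₀.arrow) (j : J) :
    QuasiIso (transfiniteIterate (largerSubobject hV) j A₀).arrow := by
  induction j using SuccOrder.limitRecOn with
  | isMin j hj =>
    obtain rfl := hj.eq_bot
    rwa [transfiniteIterate_bot]
  | succ j hj hj' =>
    rw [transfiniteIterate_succ _ _ _ hj]
    exact quasiIso_largerSubobject_arrow hV _ hj'
  | isSuccLimit j hj hj' =>
    have := hj.nonempty_Iio.to_subtype
    let T : Set.Iio j →o Subobject X := ⟨fun k => transfiniteIterate (largerSubobject hV) k.1 A₀,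
      fun _ _ h => monotone_transfiniteIterate _ _ (le_largerSubobject hV) h⟩
    have hT : transfiniteIterate (largerSubobject hV) j A₀ = ⨆ k, T k :=
      transfiniteIterate_limit (largerSubobject hV) A₀ j hj
    have le (k) : T k ≤ transfiniteIterate (largerSubobject hV) j A₀ := hT ▸ le_iSup _ _
    have hc := isColimitFamilyCocone T (transfiniteIterate (largerSubobject hV) j A₀).arrow
      (fun n => ofLE _ _ (le n)) (fun n => ofLE_arrow _) ((Subobject.mk_arrow _).trans hT)
    have hc' := isColimitConstCocone (Set.Iio j) X
    let φ : familyFunctor T ⟶ (Functor.const _).obj X :=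
      { app k := (T k).arrow
        naturality k l f := by
          exact (Subobject.ofLE_arrow _).trans (Category.comp_id _).symm }
    -- At a limit stage the inclusion is the filtered colimit of the earlier inclusions, seen as
    -- maps to the constant diagram `X`.
    exact MorphismProperty.colimitsOfShape_le (W := quasiIso A (ComplexShape.up ℤ)) _
      (colimitsOfShape.mk' (familyFunctor T) _ _ _ hc hc' φ
        (fun k => hj' k.1 k.2) _ (fun k => by
          exact (Subobject.ofLE_arrow _).trans (Category.comp_id _).symm))

instance : (functor hV A₀ J).IsWellOrderContinuous where
  nonempty_isColimit m hm := ⟨by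
    have := hm.nonempty_Iio.to_subtype
    let c := (Set.principalSegIio m).cocone (functorToMonoOver hV A₀ J ⋙ MonoOver.forget _)
    have : Mono c.pt.hom :=
      inferInstanceAs (Mono (transfiniteIterate (largerSubobject hV) m A₀).arrow)
    apply IsGrothendieckAbelian.isColimitMapCoconeOfSubobjectMkEqISup
      ((Set.principalSegIio m).monotone.functor ⋙ functorToMonoOver hV A₀ J) c
    refine (Subobject.mk_arrow _).trans ((transfiniteIterate_limit (largerSubobject hV) A₀ m hm
      ).trans ?_)
    exact iSup_congr (fun k => (Subobject.mk_arrow _).symm)⟩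

variable {J} in
/-- The iterates of `largerSubobject` form a transfinite composition of pushouts of maps
in `generatingAcyclicMono V`. -/
def transfiniteCompositionOfShapeMapFromBot (hA₀ : QuasiIso A₀.arrow) (j : J) :
    (generatingAcyclicMono V).pushouts.TransfiniteCompositionOfShape (Set.Iic j)
    ((functor hV A₀ J).map (homOfLE bot_le : ⊥ ⟶ j)) where
  F := (Set.initialSegIic j).monotone.functor ⋙ functor hV A₀ J
  isoBot := Iso.refl _
  incl :=
    { app k := (functor hV A₀ J).map (homOfLE k.2)
      naturality k k' h := by
        refine Eq.trans ?_ (Category.comp_id _).symm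
        exact ((functor hV A₀ J).map_comp ((Set.initialSegIic j).monotone.functor.map h)
          (homOfLE k'.2)).symm }
  fac := Category.id_comp _
  isColimit := colimitOfDiagramTerminal isTerminalTop _
  map_mem k hk := by
    have := pushouts_ofLE_le_largerSubobject hV _
      (quasiIso_transfiniteIterate_arrow hV A₀ J hA₀ k.1)
    have aux {B B' : Subobject X} (h : B ≤ B') (hB : largerSubobject hV B = B')
        (H : (generatingAcyclicMono V).pushouts (Subobject.ofLE _ _ (le_largerSubobject hV B))) :
        (generatingAcyclicMono V).pushouts (Subobject.ofLE _ _ h) := by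
      subst hB
      exact H
    refine aux _ ?_ this
    change _ = transfiniteIterate (largerSubobject hV) (Order.succ k).1 A₀
    rw [Set.Iic.succ_eq_of_not_isMax hk]
    exact (transfiniteIterate_succ _ _ _ (Set.not_isMax_coe _ hk)).symm

end

lemma exists_transfiniteCompositionOfShape (hV : DetectsAcyclic V) {Y : CochainComplex A ℤ}
    (f : Y ⟶ X) (hf : acyclicMono A f) :
    ∃ (J : Type v) (_ : LinearOrder J) (_ : OrderBot J) (_ : SuccOrder J)
        (_ : WellFoundedLT J),
    Nonempty ((generatingAcyclicMono V).pushouts.TransfiniteCompositionOfShape J f) := by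
  have : Mono f := hf.1
  have hf' : QuasiIso (Subobject.mk f).arrow := by
    have : QuasiIso f := hf.2
    rw [← Subobject.underlyingIso_hom_comp_eq_mk]
    infer_instance
  obtain ⟨o, j, hj⟩ := exists_ordinal hV (Subobject.mk f)
  have : Nonempty o.ToType := ⟨j⟩
  have : OrderBot o.ToType := WellFoundedLT.toOrderBot _
  refine ⟨Set.Iic j, inferInstance, inferInstance, inferInstance, inferInstance, ⟨?_⟩⟩
  let t := transfiniteIterate (largerSubobject hV) j (Subobject.mk f)
  have ht : IsIso t.arrow := (Subobject.isIso_arrow_iff_eq_top t).2 hj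
  let e : (t : CochainComplex A ℤ) ≅ X := asIso t.arrow
  apply (transfiniteCompositionOfShapeMapFromBot hV (Subobject.mk f) hf' j).ofArrowIso
  refine CategoryTheory.Arrow.isoMk ((Subobject.isoOfEq _ _ (transfiniteIterate_bot _ _) ≪≫
    Subobject.underlyingIso f)) e ?_
  refine (Category.assoc _ _ _).trans ?_
  refine (congrArg (_ ≫ ·) (Subobject.underlyingIso_hom_comp_eq_mk f)).trans ?_
  exact (Subobject.ofLE_arrow _).trans (Subobject.ofLE_arrow _).symm

end generatingAcyclicMono

/-- Every acyclic monomorphism is a transfinite composition of pushouts of generators, and lifting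
properties pass to such compositions. -/
lemma rlp_generatingAcyclicMono [IsGrothendieckAbelian.{v} A] {V : CochainComplex A ℤ}
    (hV : DetectsAcyclic V) : (generatingAcyclicMono V).rlp = (acyclicMono A).rlp := by
  refine le_antisymm (fun X Y p hp A B i hi => ?_) (antitone_rlp (generatingAcyclicMono_le _))
  obtain ⟨J, _, _, _, _, ⟨h⟩⟩ :=
    generatingAcyclicMono.exists_transfiniteCompositionOfShape hV i hi
  exact transfiniteCompositionsOfShape_le_llp_rlp _ _ _ h.mem _ (by simpa)

end

end CochainComplex
end

/-! ### K-injective resolutions by the small object argument. -/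

noncomputable section

namespace CategoryTheory.IsGrothendieckAbelian

open MorphismProperty

/-- In a Grothendieck abelian category, any small class of monomorphisms permits the small object
argument. -/
lemma hasSmallObjectArgument {C : Type u} [Category.{v} C] [Abelian C]
    [IsGrothendieckAbelian.{v} C] (I : MorphismProperty C) [IsSmall.{v} I]
    (hI : I ≤ monomorphisms C) : HasSmallObjectArgument.{v} I := by
  -- Maps out of an object with fewer than `κ` subobjects commute with `κ`-filtered colimits of
  -- monomorphisms; this `κ` works for every source in `I`.
  obtain ⟨κ, hκ', hκ⟩ := HasCardinalLT.exists_regular_cardinal_forall.{v}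
    (fun i : I.toSet => Subobject i.1.left)
  have : Fact κ.IsRegular := ⟨hκ'⟩
  have : Nonempty κ.ord.ToType := by simpa using hκ'.ne_zero
  have := WellFoundedLT.toOrderBot κ.ord.ToType
  exact ⟨κ, inferInstance, inferInstance,
    { preservesColimit {A B X Y} i hi f hf := by
        let hf' : (monomorphisms C).TransfiniteCompositionOfShape κ.ord.ToType f :=
          { toTransfiniteCompositionOfShape := hf.toTransfiniteCompositionOfShape
            map_mem j hj := by
              have := (hf.attachCells j hj).pushouts_coproducts
              simp only [ofHoms_homFamily] at this
              refine (?_ : _ ≤ monomorphisms C) _ this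
              simp only [pushouts_le_iff, coproducts_le_iff]
              exact hI }
        have (j j' : κ.ord.ToType) (φ : j ⟶ j') : Mono (hf'.F.map φ) := hf'.mem_map φ
        exact preservesColimit_coyoneda_obj_of_mono (Y := hf'.F) (κ := κ) (hκ ⟨Arrow.mk i, hi⟩) }⟩

end CategoryTheory.IsGrothendieckAbelian

namespace CochainComplex

open HomologicalComplex MorphismProperty
open scoped ZeroObject

variable {A : Type u} [Category.{v} A] [Abelian A]

lemma acyclic_mappingCone {K L : CochainComplex A ℤ} (f : K ⟶ L) (hK : K.Acyclic)
    (hL : L.Acyclic) : HomologicalComplex.Acyclic (mappingCone f) := by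
  rw [← HomotopyCategory.quotient_obj_mem_subcategoryAcyclic_iff_acyclic] at hK hL ⊢
  exact (HomotopyCategory.subcategoryAcyclic A).ext_of_isTriangulatedClosed₃ _
    (HomotopyCategory.mappingCone_triangleh_distinguished f) hK hL

instance mono_mappingCone_inr {K L : CochainComplex A ℤ} (f : K ⟶ L) :
    Mono (mappingCone.inr f) := by
  have (n : ℤ) : Mono ((mappingCone.inr f).f n) :=
    mono_of_mono_fac (mappingCone.inr_f_snd_v f n)
  exact mono_of_mono_f _ inferInstance

/-- For acyclic `K`, the inclusion of `K` in the cone of `𝟙 K` is an acyclic monomorphism and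
null-homotopic. A map `K ⟶ L` extends along it, so it is null-homotopic too. -/
lemma isKInjective_of_rlp {L : CochainComplex A ℤ} (hL : (acyclicMono A).rlp (0 : L ⟶ 0)) :
    L.IsKInjective where
  nonempty_homotopy_zero {K} f hK := by
    have hc := acyclic_mappingCone (𝟙 K) hK hK
    have hi : acyclicMono A (mappingCone.inr (𝟙 K)) := by
      refine ⟨inferInstanceAs (Mono _), ?_⟩
      rw [mem_quasiIso_iff, _root_.quasiIso_iff]
      intro i
      rw [quasiIsoAt_iff_isIso_homologyMap]
      exact ((exactAt_iff_isZero_homology _ _).1 (hK i)).isIso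
        ((exactAt_iff_isZero_homology _ _).1 (hc i)) _
    have := hL _ hi
    have sq : CommSq f (mappingCone.inr (𝟙 K)) (0 : L ⟶ 0) 0 := ⟨by simp⟩
    refine ⟨(Homotopy.ofEq ?_).trans
      (((homotopyCofiber.inrCompHomotopy (𝟙 K) (fun j => ⟨j - 1, by simp⟩)).compRight
        sq.lift).trans (Homotopy.ofEq zero_comp))⟩
    rw [Category.id_comp]
    exact sq.fac_left.symm

/-- There are enough K-injective complexes in a Grothendieck abelian category. -/
lemma exists_quasiIso_isKInjective [IsGrothendieckAbelian.{v} A] (K : CochainComplex A ℤ) :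
    ∃ (L : CochainComplex A ℤ) (i : K ⟶ L), L.IsKInjective ∧ QuasiIso i := by
  obtain ⟨V, hV⟩ := exists_detectsAcyclic (A := A)
  have : IsSmall.{v} (generatingAcyclicMono V) := by
    dsimp only [generatingAcyclicMono]
    infer_instance
  have := IsGrothendieckAbelian.hasSmallObjectArgument (generatingAcyclicMono V)
    ((generatingAcyclicMono_le V).trans (fun _ _ _ h => h.1))
  let fac := (functorialFactorizationData (generatingAcyclicMono V).rlp.llp
    (generatingAcyclicMono V).rlp).factorizationData (0 : K ⟶ 0)
  refine ⟨fac.Z, fac.i, isKInjective_of_rlp ?_, ?_⟩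
  · rw [← rlp_generatingAcyclicMono hV, (isZero_zero _).eq_of_tgt 0 fac.p]
    exact fac.hp
  -- The left factor is a retract of a transfinite composition of pushouts of coproducts of
  -- generators, and acyclic monomorphisms are closed under all of these.
  · have h : (generatingAcyclicMono V).rlp.llp ≤ acyclicMono A := by
      rw [llp_rlp_of_hasSmallObjectArgument, retracts_le_iff]
      refine (transfiniteCompositions_monotone.{v} ?_).trans (transfiniteCompositions_le.{v} _)
      rw [pushouts_le_iff, coproducts_le_iff]
      exact generatingAcyclicMono_le V
    exact (h _ fac.hi).2

end CochainComplex
end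

/-! ### Solution sets and universal cofiltered cones. -/

noncomputable section

namespace CategoryTheory

open CategoryTheory.Subobject

variable {C : Type u₁} [Category.{v} C] {D : Type u₂} [Category.{v} D] (H : C ⥤ D)

/-- The solution set condition for a left exact functor that preserves filtered colimits. -/
lemma exists_solutionSet [Abelian C] [IsGrothendieckAbelian.{v} C] [Abelian D]
    [IsGrothendieckAbelian.{v} D] [PreservesFiniteLimits H]
    [PreservesFilteredColimitsOfSize.{v, v} H] (X : D) :
    ∃ (ι : Type v) (K : ι → C), ∀ (Y : C) (f : X ⟶ H.obj Y),
      ∃ (i : ι) (g : X ⟶ H.obj (K i)) (φ : K i ⟶ Y), g ≫ H.map φ = f := by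
  obtain ⟨κ, hκ, hX⟩ := HasCardinalLT.exists_regular_cardinal.{v} (Subobject X)
  have : Fact κ.IsRegular := ⟨hκ⟩
  let U := separator C
  have hU : IsSeparator U := isSeparator_separator C
  -- The solution set consists of the quotients of `N`. The first summand carries only the zero map.
  let N : C := U ⨿ ∐ fun _ : κ.ord.ToType => U
  refine ⟨Shrink.{v} (Subobject N), fun S => cokernel ((equivShrink _).symm S).arrow,
    fun Y f => ?_⟩
  let T : SmallSubset κ (U ⟶ Y) →o Subobject Y :=
    generatedFamily κ (𝟙 Y) (imageSubobject ((0 : U ⟶ Y) ≫ 𝟙 Y))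
  have hc := isColimitFamilyCocone T (𝟙 Y) (fun S => (T S).arrow) (fun _ => Category.comp_id _)
    (((isIso_iff_mk_eq_top (𝟙 Y)).1 inferInstance).trans
      (iSup_generatedFamily κ hU (𝟙 Y) _).symm)
  have (S S') (φ : S ⟶ S') : Mono ((familyFunctor T ⋙ H).map φ) :=
    inferInstanceAs (Mono (H.map ((familyFunctor T).map φ)))
  -- `H` turns `Y` into a `κ`-filtered colimit of the `H (T S)` along monomorphisms, so `f` factors
  -- through some `H (T S)`, where `T S` is a quotient of `N`.
  obtain ⟨S, y, hy⟩ := IsGrothendieckAbelian.IsPresentable.surjectivity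
    (isColimitOfPreserves H hc) hX f
  obtain ⟨e, he⟩ := exists_sigmaDesc_eq_generatedFamily (κ := κ) (𝟙 Y) (0 : U ⟶ Y) S
  obtain ⟨K, ⟨ψ⟩⟩ := exists_iso_cokernel_arrow
    (factorThruImageSubobject (coprod.desc 0 e ≫ 𝟙 Y) ≫ (isoOfEq _ _ he).hom)
  obtain ⟨K, rfl⟩ := (equivShrink (Subobject N)).symm.surjective K
  refine ⟨K, y ≫ H.map ψ.inv, ψ.hom ≫ (T S).arrow, ?_⟩
  have aux {L Q : C} (ψ : L ≅ Q) (a : Q ⟶ Y) (y : X ⟶ H.obj Q) :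
      (y ≫ H.map ψ.inv) ≫ H.map (ψ.hom ≫ a) = y ≫ H.map a := by
    rw [Category.assoc, ← H.map_comp, Iso.inv_hom_id_assoc]
  exact (aux ψ (T S).arrow y).trans hy.symm

/-- A left exact functor that satisfies the solution set condition is pro-corepresentable: there
is a universal cofiltered cone. -/
lemma exists_cofiltered_cone [HasFiniteLimits C] [PreservesFiniteLimits H] (X : D)
    (hX : ∃ (ι : Type v) (K : ι → C), ∀ (Y : C) (f : X ⟶ H.obj Y),
      ∃ (i : ι) (g : X ⟶ H.obj (K i)) (φ : K i ⟶ Y), g ≫ H.map φ = f) :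
    ∃ (I : Type v) (_ : SmallCategory I) (_ : IsCofiltered I) (K : I ⥤ C)
      (η : (Functor.const I).obj X ⟶ K ⋙ H),
      (∀ (Y : C) (f : X ⟶ H.obj Y), ∃ (i : I) (φ : K.obj i ⟶ Y), η.app i ≫ H.map φ = f) ∧
      ∀ (i : I) (Y : C) (φ φ' : K.obj i ⟶ Y), η.app i ≫ H.map φ = η.app i ≫ H.map φ' →
        ∃ (i' : I) (t : i' ⟶ i), K.map t ≫ φ = K.map t ≫ φ' := by
  obtain ⟨ι, K, hK⟩ := hX
  -- The index category is the small full subcategory of structured arrows given by the solution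
  -- set. It inherits cofilteredness because each structured arrow receives a map from it.
  let T (x : Σ i, (X ⟶ H.obj (K i))) : StructuredArrow X H := StructuredArrow.mk x.2
  have : RepresentablyFlat H := flat_of_preservesFiniteLimits H
  have : IsCofiltered (InducedCategory _ T) :=
    IsCofiltered.of_exists_of_isCofiltered_of_fullyFaithful (inducedFunctor T) (fun Y => by
      obtain ⟨i, g, φ, h⟩ := hK Y.right Y.hom
      exact ⟨⟨i, g⟩, ⟨StructuredArrow.homMk φ h⟩⟩)
  refine ⟨InducedCategory _ T, inferInstance, inferInstance,
    inducedFunctor T ⋙ StructuredArrow.proj X H,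
    { app i := i.2
      naturality i j f := (Category.id_comp _).trans (StructuredArrow.w f.hom).symm },
    fun Y f => ?_, fun i Y φ φ' h => ?_⟩
  · obtain ⟨i, g, φ, h⟩ := hK Y f
    exact ⟨⟨i, g⟩, φ, h⟩
  -- `H` preserves the equalizer of `φ` and `φ'`, so the structure arrow factors through its image;
  -- the solution set then provides the index `i'`.
  · let k := isLimitForkMapOfIsLimit H (equalizer.condition φ φ') (equalizerIsEqualizer φ φ')
    obtain ⟨f, hf⟩ := Fork.IsLimit.lift' k i.2 h
    obtain ⟨j, g, ψ, hψ⟩ := hK _ f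
    refine ⟨⟨j, g⟩, InducedCategory.homMk (StructuredArrow.homMk (ψ ≫ equalizer.ι φ φ') ?_), ?_⟩
    · refine (congrArg (g ≫ ·) (H.map_comp _ _)).trans ((Category.assoc _ _ _).symm.trans ?_)
      exact (congrArg (· ≫ _) hψ).trans hf
    · exact (Category.assoc _ _ _).trans ((congrArg (ψ ≫ ·) (equalizer.condition φ φ')).trans
        (Category.assoc _ _ _).symm)

end CategoryTheory
end

/-! ### Maps of ind- and pro-objects, and the pro-left adjoint of `G`. -/

noncomputable section

namespace CategoryTheory.Ind

variable {C : Type u} [Category.{v} C]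

/-- The Yoneda lemma for ind-objects. -/
def yonedaHomEquiv (Y : C) (Z : Ind C) :
    (Ind.yoneda.obj Y ⟶ Z) ≃ ((Ind.inclusion C).obj Z).obj (op Y) :=
  Ind.inclusion.fullyFaithful.homEquiv.trans
    (((Ind.yonedaCompInclusion.app Y).homCongr (Iso.refl _)).trans yonedaEquiv)

lemma yonedaHomEquiv_apply {Y : C} {Z : Ind C} (g : Ind.yoneda.obj Y ⟶ Z) :
    yonedaHomEquiv Y Z g =
      yonedaEquiv (Ind.yonedaCompInclusion.inv.app Y ≫ (Ind.inclusion C).map g) := by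
  change yonedaEquiv (Ind.yonedaCompInclusion.inv.app Y ≫ (Ind.inclusion C).map g ≫ 𝟙 _) = _
  rw [Category.comp_id]

lemma yonedaHomEquiv_comp {Y : C} {Z Z' : Ind C} (g : Ind.yoneda.obj Y ⟶ Z) (f : Z ⟶ Z') :
    yonedaHomEquiv Y Z' (g ≫ f) =
      ((Ind.inclusion C).map f).app (op Y) (yonedaHomEquiv Y Z g) := by
  simp only [yonedaHomEquiv_apply, Functor.map_comp, ← Category.assoc]
  exact yonedaEquiv_comp _ _

lemma hom_ext {Z Z' : Ind C} {f g : Z ⟶ Z'}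
    (h : ∀ Y (t : Ind.yoneda.obj Y ⟶ Z), t ≫ f = t ≫ g) : f = g := by
  apply (Ind.inclusion C).map_injective
  ext Y x
  obtain ⟨t, rfl⟩ := (yonedaHomEquiv Y.unop Z).surjective x
  exact (yonedaHomEquiv_comp _ _).symm.trans
    ((congrArg (yonedaHomEquiv Y.unop Z') (h _ t)).trans (yonedaHomEquiv_comp _ _))

lemma isIso_of_bijective {Z Z' : Ind C} (f : Z ⟶ Z')
    (h : ∀ Y : C, Function.Bijective (fun g : Ind.yoneda.obj Y ⟶ Z => g ≫ f)) : IsIso f := by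
  have : IsIso ((Ind.inclusion C).map f) := by
    rw [NatTrans.isIso_iff_isIso_app]
    intro Y
    rw [isIso_iff_bijective]
    have e : yonedaHomEquiv Y.unop Z' ∘ (fun g => g ≫ f) =
        ((Ind.inclusion C).map f).app Y ∘ yonedaHomEquiv Y.unop Z :=
      funext (fun g => yonedaHomEquiv_comp g f)
    refine (Function.Bijective.of_comp_iff _ (yonedaHomEquiv Y.unop Z).bijective).1 ?_
    exact e ▸ (yonedaHomEquiv Y.unop Z').bijective.comp (h Y.unop)
  exact isIso_of_reflects_iso f (Ind.inclusion C)

section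

variable {J : Type v} [SmallCategory J] [IsFiltered J] (D : J ⥤ C)

/-- The values of a formal filtered colimit are filtered colimits of sets. -/
def isColimitEvaluation (Y : C) :
    IsColimit ((Ind.inclusion C ⋙ (evaluation _ _).obj (op Y)).mapCocone
      (colimit.cocone (D ⋙ Ind.yoneda))) :=
  isColimitOfPreserves _ (colimit.isColimit _)

lemma exists_eq_comp_ι {Y : C} (f : Ind.yoneda.obj Y ⟶ colimit (D ⋙ Ind.yoneda)) :
    ∃ (j : J) (g : Y ⟶ D.obj j), Ind.yoneda.map g ≫ colimit.ι (D ⋙ Ind.yoneda) j = f := by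
  obtain ⟨j, x, hx⟩ := Types.jointly_surjective_of_isColimit (isColimitEvaluation D Y)
    (yonedaHomEquiv Y _ f)
  obtain ⟨x, rfl⟩ := (yonedaHomEquiv Y (Ind.yoneda.obj (D.obj j))).surjective x
  obtain ⟨x, rfl⟩ := Ind.yoneda.map_surjective x
  exact ⟨j, x, (yonedaHomEquiv Y _).injective ((yonedaHomEquiv_comp _ _).trans hx)⟩

lemma exists_comp_map_eq {Y : C} {j : J} (g g' : Y ⟶ D.obj j)
    (h : Ind.yoneda.map g ≫ colimit.ι (D ⋙ Ind.yoneda) j =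
      Ind.yoneda.map g' ≫ colimit.ι (D ⋙ Ind.yoneda) j) :
    ∃ (j' : J) (φ : j ⟶ j'), g ≫ D.map φ = g' ≫ D.map φ := by
  obtain ⟨j', φ, φ', h'⟩ := (Types.FilteredColimit.isColimit_eq_iff _ (isColimitEvaluation D Y)
    (xi := yonedaHomEquiv Y (Ind.yoneda.obj (D.obj j)) (Ind.yoneda.map g))
    (xj := yonedaHomEquiv Y (Ind.yoneda.obj (D.obj j)) (Ind.yoneda.map g'))).1
      ((yonedaHomEquiv_comp _ _).symm.trans
        ((congrArg (yonedaHomEquiv Y _) h).trans (yonedaHomEquiv_comp _ _)))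
  have h'' : g ≫ D.map φ = g' ≫ D.map φ' := by
    apply Ind.yoneda.map_injective
    rw [Functor.map_comp, Functor.map_comp]
    apply (yonedaHomEquiv Y _).injective
    exact (yonedaHomEquiv_comp _ _).trans (h'.trans (yonedaHomEquiv_comp _ _).symm)
  refine ⟨_, φ ≫ IsFiltered.coeqHom φ φ', ?_⟩
  rw [D.map_comp, reassoc_of% h'', ← D.map_comp, ← D.map_comp, IsFiltered.coeq_condition]

end

end CategoryTheory.Ind

namespace ProCat

variable {C : Type u} [Category.{v} C]

section

variable {I : Type v} [SmallCategory I] [IsCofiltered I] (D : I ⥤ C)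

lemma proj_map {i j : I} (φ : i ⟶ j) :
    proj D i ≫ (const C).map (D.map φ) = proj D j :=
  Quiver.Hom.unop_inj (colimit.w (D.op ⋙ Ind.yoneda) φ.op)

variable {D} in
lemma exists_lift {P : ProCat C} (f : ∀ i, P ⟶ (const C).obj (D.obj i))
    (hf : ∀ ⦃i j⦄ (φ : i ⟶ j), f i ≫ (const C).map (D.map φ) = f j) :
    ∃ l : P ⟶ formalLim D, ∀ i, l ≫ proj D i = f i := by
  let c : Cocone (D.op ⋙ Ind.yoneda) :=
    { pt := P.unop
      ι :=
        { app i := (f i.unop).unop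
          naturality i j φ :=
            (congrArg Quiver.Hom.unop (hf φ.unop)).trans (Category.comp_id _).symm } }
  exact ⟨(colimit.desc (D.op ⋙ Ind.yoneda) c).op,
    fun i => Quiver.Hom.unop_inj (colimit.ι_desc c (op i))⟩

variable {D} in
lemma exists_eq_proj_comp {Y : C} (f : formalLim D ⟶ (const C).obj Y) :
    ∃ (i : I) (g : D.obj i ⟶ Y), proj D i ≫ (const C).map g = f := by
  obtain ⟨i, g, h⟩ := Ind.exists_eq_comp_ι D.op f.unop
  exact ⟨i.unop, g.unop, Quiver.Hom.unop_inj h⟩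

variable {D} in
lemma exists_map_comp_eq {Y : C} {i : I} (g g' : D.obj i ⟶ Y)
    (h : proj D i ≫ (const C).map g = proj D i ≫ (const C).map g') :
    ∃ (i' : I) (φ : i' ⟶ i), D.map φ ≫ g = D.map φ ≫ g' := by
  obtain ⟨i', φ, h⟩ := Ind.exists_comp_map_eq D.op g.op g'.op (congrArg Quiver.Hom.unop h)
  exact ⟨i'.unop, φ.unop, Quiver.Hom.op_inj h⟩

end

/-- Pro-objects are cogenerated by the constant ones. -/
lemma hom_ext {P Q : ProCat C} {f g : P ⟶ Q}
    (h : ∀ Y (t : Q ⟶ (const C).obj Y), f ≫ t = g ≫ t) : f = g :=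
  Quiver.Hom.unop_inj (Ind.hom_ext (fun Y t => Quiver.Hom.op_inj (h Y.unop t.op)))

/-- Isomorphisms of pro-objects are detected by the maps to constant pro-objects. -/
lemma isIso_of_bijective {P Q : ProCat C} (f : P ⟶ Q)
    (h : ∀ Y : C, Function.Bijective (fun g : Q ⟶ (const C).obj Y => f ≫ g)) : IsIso f := by
  have : IsIso f.unop := Ind.isIso_of_bijective _ (fun Y =>
    (Quiver.Hom.opEquiv.symm.bijective.comp (h Y.unop)).comp Quiver.Hom.opEquiv.bijective)
  exact (isIso_unop_iff f).1 this

end ProCat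

section

variable {A : Type u₁} [Category.{v} A] {B : Type u₂} [Category.{v} B] (G : A ⥤ B)

/-- A pro-left adjoint can be constructed objectwise. -/
lemma nonempty_proLeftAdjoint (R : B → ProCat A)
    (e : ∀ X Y, (R X ⟶ (ProCat.const A).obj Y) ≃ (X ⟶ G.obj Y))
    (he : ∀ X {Y Y' : A} (g : R X ⟶ (ProCat.const A).obj Y) (h : Y ⟶ Y'),
      e X Y' (g ≫ (ProCat.const A).map h) = e X Y g ≫ G.map h)
    (hR : ∀ X X' (f : X' ⟶ X), ∃ f' : R X' ⟶ R X, ∀ Y (g : R X ⟶ (ProCat.const A).obj Y),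
      e X' Y (f' ≫ g) = f ≫ e X Y g) :
    Nonempty (ProLeftAdjoint G) := by
  choose m hm using hR
  have ext {X X' : B} {f g : R X' ⟶ R X}
      (h : ∀ Y (t : R X ⟶ (ProCat.const A).obj Y), f ≫ t = g ≫ t) : f = g :=
    ProCat.hom_ext h
  exact ⟨{
    functor :=
      { obj := R
        map {X' X} f := m X X' f
        map_id X := ext (fun Y t => (e _ _).injective (by simp [hm]))
        map_comp f g := ext (fun Y t => (e _ _).injective (by simp [hm])) }
    homEquiv := e
    homEquiv_naturality_left f g := hm _ _ f _ g
    homEquiv_naturality_right g h := he _ g h }⟩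

/-- Maps from `"lim" K` to `Y` form the filtered colimit of the sets `Hom (K i, Y)`. The two
conditions on the cone identify this colimit with `Hom (X, G Y)`. -/
lemma nonempty_proLeftAdjoint_of_exists_cone
    (hG : ∀ X : B, ∃ (I : Type v) (_ : SmallCategory I) (_ : IsCofiltered I) (K : I ⥤ A)
      (η : (Functor.const I).obj X ⟶ K ⋙ G),
      (∀ (Y : A) (f : X ⟶ G.obj Y), ∃ (i : I) (φ : K.obj i ⟶ Y), η.app i ≫ G.map φ = f) ∧
      ∀ (i : I) (Y : A) (φ φ' : K.obj i ⟶ Y), η.app i ≫ G.map φ = η.app i ≫ G.map φ' →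
        ∃ (i' : I) (t : i' ⟶ i), K.map t ≫ φ = K.map t ≫ φ') :
    Nonempty (ProLeftAdjoint G) := by
  choose I _ _ K η hη hη' using hG
  have hη'' (X : B) {i j : I X} (φ : i ⟶ j) : (η X).app i ≫ G.map ((K X).map φ) = (η X).app j :=
    ((η X).naturality φ).symm.trans (Category.id_comp _)
  have key (X : B) (Y : A) : ∃ e : (ProCat.formalLim (K X) ⟶ (ProCat.const A).obj Y) ≃
      (X ⟶ G.obj Y), ∀ (i : I X) (φ : (K X).obj i ⟶ Y),
        e (ProCat.proj _ i ≫ (ProCat.const A).map φ) = (η X).app i ≫ G.map φ := by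
    choose i φ hφ using fun f : ProCat.formalLim (K X) ⟶ (ProCat.const A).obj Y =>
      ProCat.exists_eq_proj_comp f
    -- Independence of the chosen representative `φ f` of `f`: any two representatives agree over a
    -- common index.
    have hc (j : I X) (ψ : (K X).obj j ⟶ Y) (f : ProCat.formalLim (K X) ⟶ (ProCat.const A).obj Y)
        (h : ProCat.proj _ j ≫ (ProCat.const A).map ψ = f) :
        (η X).app (i f) ≫ G.map (φ f) = (η X).app j ≫ G.map ψ := by
      obtain ⟨k, t, s, -⟩ := IsCofilteredOrEmpty.cone_objs (i f) j
      obtain ⟨l, r, hr⟩ := ProCat.exists_map_comp_eq ((K X).map t ≫ φ f) ((K X).map s ≫ ψ) (by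
        rw [Functor.map_comp, Functor.map_comp, ← Category.assoc, ← Category.assoc,
          ProCat.proj_map, ProCat.proj_map, hφ, h])
      have hr' : (K X).map (r ≫ t) ≫ φ f = (K X).map (r ≫ s) ≫ ψ := by
        rw [(K X).map_comp, (K X).map_comp, Category.assoc, Category.assoc, hr]
      rw [← hη'' X (r ≫ t), ← hη'' X (r ≫ s), Category.assoc, Category.assoc, ← G.map_comp,
        ← G.map_comp, hr']
    refine ⟨Equiv.ofBijective (fun f => (η X).app (i f) ≫ G.map (φ f))
      ⟨fun f f' h => ?_, fun f => ?_⟩, fun j ψ => hc j ψ _ rfl⟩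
    · obtain ⟨k, t, s, -⟩ := IsCofilteredOrEmpty.cone_objs (i f) (i f')
      obtain ⟨l, r, hr⟩ := hη' X k Y ((K X).map t ≫ φ f) ((K X).map s ≫ φ f') (by
        rw [G.map_comp, G.map_comp, ← Category.assoc, ← Category.assoc, hη'', hη'']
        exact h)
      have hr' : (K X).map (r ≫ t) ≫ φ f = (K X).map (r ≫ s) ≫ φ f' := by
        rw [(K X).map_comp, (K X).map_comp, Category.assoc, Category.assoc, hr]
      rw [← hφ f, ← hφ f', ← ProCat.proj_map _ (r ≫ t), ← ProCat.proj_map _ (r ≫ s),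
        Category.assoc, Category.assoc, ← Functor.map_comp, ← Functor.map_comp, hr']
    · obtain ⟨j, ψ, hψ⟩ := hη X Y f
      exact ⟨ProCat.proj _ j ≫ (ProCat.const A).map ψ, (hc j ψ _ rfl).trans hψ⟩
  choose e he using key
  have he' (X) {Y Y' : A} (g : ProCat.formalLim (K X) ⟶ (ProCat.const A).obj Y) (h : Y ⟶ Y') :
      e X Y' (g ≫ (ProCat.const A).map h) = e X Y g ≫ G.map h := by
    obtain ⟨i, φ, rfl⟩ := ProCat.exists_eq_proj_comp g
    rw [Category.assoc, ← Functor.map_comp, he, he, G.map_comp, Category.assoc]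
  refine nonempty_proLeftAdjoint G (fun X => ProCat.formalLim (K X)) e he' (fun X X' f => ?_)
  obtain ⟨l, hl⟩ := ProCat.exists_lift (D := K X)
    (fun i => (e X' _).symm (f ≫ (η X).app i)) (fun i j φ => (e X' _).injective (by
      rw [he', Equiv.apply_symm_apply, Equiv.apply_symm_apply, Category.assoc, hη'']))
  refine ⟨l, fun Y g => ?_⟩
  obtain ⟨i, φ, rfl⟩ := ProCat.exists_eq_proj_comp g
  rw [← Category.assoc, hl, he', Equiv.apply_symm_apply, he, Category.assoc]

/-- A left exact functor between Grothendieck abelian categories that preserves filtered colimits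
has a pro-left adjoint. -/
lemma nonempty_proLeftAdjoint_of_preservesFiniteLimits [Abelian A] [IsGrothendieckAbelian.{v} A]
    [Abelian B] [IsGrothendieckAbelian.{v} B] [PreservesFiniteLimits G]
    [PreservesFilteredColimitsOfSize.{v, v} G] : Nonempty (ProLeftAdjoint G) :=
  nonempty_proLeftAdjoint_of_exists_cone G (fun X => by
    obtain ⟨I, _, _, K, η, h₁, h₃⟩ := exists_cofiltered_cone G X (exists_solutionSet G X)
    exact ⟨I, _, inferInstance, K, η, h₁, h₃⟩)

end
end

/-! ### Cells and cellular resolutions. -/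

noncomputable section

namespace CochainComplex

open HomologicalComplex MorphismProperty

section

variable {B : Type u} [Category.{v} B] [Abelian B]

lemma up_rel (n : ℤ) : (ComplexShape.up ℤ).Rel n (n + 1) := rfl

/-- The inclusion of an object placed in degree `n + 1` in the contractible complex given by the
identity of this object in degrees `n` and `n + 1`. -/
def cell (P : B) (n : ℤ) : (single B (ComplexShape.up ℤ) (n + 1)).obj P ⟶
    double (𝟙 P) (up_rel n) :=
  mkHomFromSingle (doubleXIso₁ _ _ (by simp)).inv
    (fun k _ => by rw [double_d_eq_zero₀ _ _ _ _ (by simp), comp_zero])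

instance mono_cell (P : B) (n : ℤ) : Mono (cell P n) := by
  refine mono_of_mono_f _ (fun k => ?_)
  by_cases hk : k = n + 1
  · subst hk
    rw [cell, mkHomFromSingle_f]
    infer_instance
  · exact (isZero_single_obj_X _ _ _ _ hk).mono _

/-- The cells attached to a family of objects. -/
def cells {ι : Type v} (P : ι → B) : MorphismProperty (CochainComplex B ℤ) :=
  ofHoms (fun x : ι × ULift.{v} ℤ => cell (P x.1) x.2.down)

instance {ι : Type v} (P : ι → B) : IsSmall.{v} (cells P) := by
  dsimp only [cells]
  infer_instance

lemma cells_le_monomorphisms {ι : Type v} (P : ι → B) : cells P ≤ monomorphisms _ := by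
  rintro _ _ _ ⟨x⟩
  exact mono_cell _ _

lemma cell_f (P : B) (n : ℤ) : (cell P n).f (n + 1) =
    (singleObjXSelf (ComplexShape.up ℤ) (n + 1) P).hom ≫
      (doubleXIso₁ (𝟙 P) (up_rel n) (by simp)).inv :=
  mkHomFromSingle_f _ _

/-- A map from the source of the cell is a `P`-valued cocycle `z` in degree `n + 1`; a map from its
target is a `P`-valued element `w` of degree `n`. -/
lemma hasLiftingProperty_cell_iff (P : B) (n : ℤ) {X Y : CochainComplex B ℤ} (f : X ⟶ Y) :
    HasLiftingProperty (cell P n) f ↔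
      ∀ (z : P ⟶ X.X (n + 1)) (w : P ⟶ Y.X n), z ≫ X.d (n + 1) (n + 1 + 1) = 0 →
        w ≫ Y.d n (n + 1) = z ≫ f.f (n + 1) →
      ∃ v : P ⟶ X.X n, v ≫ X.d n (n + 1) = z ∧ v ≫ f.f n = w := by
  constructor
  · intro h z w hz hw
    let a : (single B (ComplexShape.up ℤ) (n + 1)).obj P ⟶ X := mkHomFromSingle z
      (by rintro _ rfl; exact hz)
    let b : double (𝟙 P) (up_rel n) ⟶ Y :=
      mkHomFromDouble _ (by simp) w (z ≫ f.f _) (by rw [hw, Category.id_comp])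
        (by rintro _ rfl; rw [Category.assoc, f.comm, reassoc_of% hz, zero_comp])
    have ha : a.f (n + 1) = (singleObjXSelf (ComplexShape.up ℤ) (n + 1) P).hom ≫ z :=
      mkHomFromSingle_f _ _
    have sq : CommSq a (cell P n) f b := ⟨by
      apply HomologicalComplex.from_single_hom_ext
      rw [comp_f, comp_f, ha, cell_f, mkHomFromDouble_f₁, Category.assoc, Category.assoc,
        Iso.inv_hom_id_assoc]⟩
    have h₁ : (cell P n).f (n + 1) ≫ sq.lift.f (n + 1) = a.f (n + 1) :=
      congr_hom sq.fac_left (n + 1)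
    have h₂ : sq.lift.f n ≫ f.f n = b.f n := congr_hom sq.fac_right n
    rw [ha, cell_f, Category.assoc, cancel_epi] at h₁
    rw [mkHomFromDouble_f₀] at h₂
    refine ⟨(doubleXIso₀ _ (up_rel n)).inv ≫ sq.lift.f n, ?_, ?_⟩
    · rw [Category.assoc, sq.lift.comm, double_d _ _ (by simp), Category.assoc,
        Iso.inv_hom_id_assoc, Category.assoc, Category.id_comp, h₁]
    · rw [Category.assoc, h₂, Iso.inv_hom_id_assoc]
  · intro h
    refine ⟨fun {a b} sq => ?_⟩
    have ha : a.f (n + 1) ≫ X.d (n + 1) (n + 1 + 1) = 0 := by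
      rw [a.comm, single_obj_d, zero_comp]
    have hb := b.comm n (n + 1)
    have w : a.f (n + 1) ≫ f.f (n + 1) = (cell P n).f (n + 1) ≫ b.f (n + 1) :=
      congr_hom sq.w (n + 1)
    rw [double_d _ _ (by simp), Category.id_comp, Category.assoc] at hb
    rw [cell_f, Category.assoc] at w
    obtain ⟨v, hv₁, hv₂⟩ := h ((singleObjXSelf _ _ _).inv ≫ a.f _)
      ((doubleXIso₀ _ _).inv ≫ b.f n) (by rw [Category.assoc, ha, comp_zero])
      (by rw [Category.assoc, hb, Iso.inv_hom_id_assoc, Category.assoc, w, Iso.inv_hom_id_assoc])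
    refine ⟨⟨{ l := mkHomFromDouble _ (by simp) v (v ≫ X.d _ _) (by rw [Category.id_comp])
                 (fun _ _ => by rw [Category.assoc, d_comp_d, comp_zero])
               fac_left := ?_, fac_right := ?_ }⟩⟩
    · apply HomologicalComplex.from_single_hom_ext
      rw [comp_f, cell_f, mkHomFromDouble_f₁, Category.assoc, Iso.inv_hom_id_assoc, hv₁,
        Iso.hom_inv_id_assoc]
    · apply from_double_hom_ext
      · rw [comp_f, mkHomFromDouble_f₀, Category.assoc, hv₂, Iso.hom_inv_id_assoc]
      · rw [comp_f, mkHomFromDouble_f₁, hv₁, Category.assoc, Category.assoc, w,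
          Iso.inv_hom_id_assoc, Iso.hom_inv_id_assoc]

lemma rlp_cells_iff {ι : Type v} (P : ι → B) {X Y : CochainComplex B ℤ} (f : X ⟶ Y) :
    (cells P).rlp f ↔ ∀ (i : ι) (n m k : ℤ) (_ : n + 1 = m) (_ : m + 1 = k)
      (z : P i ⟶ X.X m) (w : P i ⟶ Y.X n), z ≫ X.d m k = 0 → w ≫ Y.d n m = z ≫ f.f m →
      ∃ v : P i ⟶ X.X n, v ≫ X.d n m = z ∧ v ≫ f.f n = w := by
  constructor
  · rintro h i n _ _ rfl rfl
    exact (hasLiftingProperty_cell_iff (P i) n f).1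
      (h _ (ofHoms.mk (f := fun x : ι × ULift.{v} ℤ => cell (P x.1) x.2.down) (i, ⟨n⟩)))
  · intro h U V g hg
    obtain ⟨i, n⟩ := hg
    exact (hasLiftingProperty_cell_iff (P i) n.down f).2 (h i _ _ _ rfl rfl)

/-- The contractible complex of pairs `(a, b)` of elements of degrees `n` and `n - 1` of a complex
`C`, which maps onto `C`. A lift of a map to this complex is a null homotopy. -/
def cover (C : CochainComplex B ℤ) : CochainComplex B ℤ where
  X n := C.X n ⊞ C.X (n - 1)
  d n m := if h : n + 1 = m then
    biprod.lift (biprod.fst ≫ C.d n m)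
      (biprod.fst ≫ (C.XIsoOfEq (show n = m - 1 by lia)).hom - biprod.snd ≫ C.d (n - 1) (m - 1))
    else 0
  shape n m h := dif_neg h
  d_comp_d' := by
    rintro n _ _ rfl rfl
    rw [dif_pos rfl, dif_pos rfl]
    ext <;> simp

namespace cover

variable (C : CochainComplex B ℤ)

/-- The first component of an element of `cover C`. -/
def fst (n : ℤ) : (cover C).X n ⟶ C.X n := biprod.fst

/-- The second component of an element of `cover C`. -/
def snd (n : ℤ) : (cover C).X n ⟶ C.X (n - 1) := biprod.snd

lemma d_fst (n m : ℤ) (h : n + 1 = m) : (cover C).d n m ≫ fst C m = fst C n ≫ C.d n m := by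
  simp [cover, dif_pos h, fst]

lemma d_snd (n m : ℤ) (h : n + 1 = m) :
    (cover C).d n m ≫ snd C m = fst C n ≫ (C.XIsoOfEq (show n = m - 1 by lia)).hom -
      snd C n ≫ C.d (n - 1) (m - 1) := by
  simp [cover, dif_pos h, fst, snd]
  rfl

variable {C} in
lemma hom_ext {Q : B} {n : ℤ} {f g : Q ⟶ (cover C).X n} (h₁ : f ≫ fst C n = g ≫ fst C n)
    (h₂ : f ≫ snd C n = g ≫ snd C n) : f = g :=
  biprod.hom_ext _ _ h₁ h₂

variable {C} in
lemma exists_lift {Q : B} {n : ℤ} (a : Q ⟶ C.X n) (b : Q ⟶ C.X (n - 1)) :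
    ∃ c : Q ⟶ (cover C).X n, c ≫ fst C n = a ∧ c ≫ snd C n = b :=
  ⟨biprod.lift a b, biprod.lift_fst _ _, biprod.lift_snd _ _⟩

/-- The projection of the contractible complex `cover C` to `C`. -/
def π : cover C ⟶ C where
  f := fst C
  comm' n m h := (d_fst C n m h).symm

lemma π_f (n : ℤ) : (π C).f n = fst C n := rfl

/-- A lift to the contractible complex `cover C` of a map to `C` is a null homotopy. -/
def homotopyOfLift {K C : CochainComplex B ℤ} (l : K ⟶ cover C) : Homotopy (l ≫ π C) 0 where
  hom i j := if h : j + 1 = i then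
    l.f i ≫ snd C i ≫ (C.XIsoOfEq (show i - 1 = j by lia)).hom else 0
  zero i j h := dif_neg h
  comm i := by
    have h := l.comm i (i + 1) =≫ snd C (i + 1)
    rw [Category.assoc, d_snd C i (i + 1) rfl, Preadditive.comp_sub, Category.assoc] at h
    have h' := h =≫ (C.XIsoOfEq (show i + 1 - 1 = i by lia)).hom
    rw [dNext_eq _ (up_rel i), prevD_eq _ (show (ComplexShape.up ℤ).Rel (i - 1) i by simp),
      dif_pos rfl, dif_pos (by simp), comp_f, π_f, zero_f, add_zero]
    simp only [Category.assoc, Preadditive.sub_comp] at h'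
    rw [← h']
    simp

end cover

/-- A complex `C` is `P`-acyclic if `Hom (P, C)` is acyclic. -/
def HomAcyclic (P : B) (C : CochainComplex B ℤ) : Prop :=
  ∀ (n m k : ℤ) (_ : n + 1 = m) (_ : m + 1 = k) (z : P ⟶ C.X m), z ≫ C.d m k = 0 →
    ∃ v : P ⟶ C.X n, v ≫ C.d n m = z

/-- For a cocycle `(z₁, z₂)` of `cover C` and `w` with `d w = z₁`, the cocycle condition reads `z₁ =
d z₂`. So `w - z₂` is a cocycle, hence of the form `d c`, and `(w, c)` is the lift. -/
lemma rlp_cells_cover_π {ι : Type v} (P : ι → B) (C : CochainComplex B ℤ)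
    (hC : ∀ i, HomAcyclic (P i) C) : (cells P).rlp (cover.π C) := by
  rw [rlp_cells_iff]
  intro i n m k hn hm z w hz hw
  rw [cover.π_f] at hw
  have hz' := hz =≫ cover.snd C k
  rw [Category.assoc, cover.d_snd C m k hm, zero_comp, Preadditive.comp_sub,
    sub_eq_zero, ← Category.assoc, ← Category.assoc, ← hw] at hz'
  have e : n = m - 1 := by lia
  obtain ⟨c, hc⟩ := hC i (n - 1) (m - 1) (k - 1) (by lia) (by lia)
    (w ≫ (C.XIsoOfEq e).hom - z ≫ cover.snd C m) (by
      rw [Preadditive.sub_comp, ← hz']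
      simp)
  obtain ⟨x, hx₁, hx₂⟩ := cover.exists_lift w c
  refine ⟨x, ?_, hx₁⟩
  apply cover.hom_ext
  · rw [Category.assoc, cover.d_fst C n m hn, reassoc_of% hx₁, hw]
  · rw [Category.assoc, cover.d_snd C n m hn, Preadditive.comp_sub, reassoc_of% hx₁,
      reassoc_of% hx₂, hc, sub_sub_cancel]

open scoped ZeroObject in
/-- A complex is `P`-cellular if it is a retract of a complex built by attaching cells. -/
def IsCellular {ι : Type v} (P : ι → B) (K : CochainComplex B ℤ) : Prop :=
  (cells P).rlp.llp (0 : 0 ⟶ K)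

open scoped ZeroObject in
lemma IsCellular.nonempty_homotopy_zero {ι : Type v} {P : ι → B} {K : CochainComplex B ℤ}
    (hK : IsCellular P K) {C : CochainComplex B ℤ} (hC : ∀ i, HomAcyclic (P i) C) (f : K ⟶ C) :
    Nonempty (Homotopy f 0) := by
  have := hK _ (rlp_cells_cover_π P C hC)
  have sq : CommSq 0 (0 : 0 ⟶ K) (cover.π C) f := ⟨by simp⟩
  exact ⟨(Homotopy.ofEq sq.fac_right.symm).trans (cover.homotopyOfLift sq.lift)⟩

variable {ι : Type v} (P : ι → B)

/-- The objects `P i` detect zero morphisms. -/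
def Detects : Prop := ∀ ⦃X Y : B⦄ (g : X ⟶ Y), (∀ (i : ι) (z : P i ⟶ X), z ≫ g = 0) → g = 0

variable {P}

lemma epi_of_detects (hP : Detects P) {X Y : B} (f : X ⟶ Y)
    (hf : ∀ (i : ι) (z : P i ⟶ Y), ∃ y, y ≫ f = z) : Epi f :=
  Preadditive.epi_of_cokernel_zero (hP _ (fun i z => by
    obtain ⟨y, rfl⟩ := hf i z
    rw [Category.assoc, cokernel.condition, comp_zero]))

lemma acyclic_of_homAcyclic (hP : Detects P) {C : CochainComplex B ℤ}
    (hC : ∀ i, HomAcyclic (P i) C) : C.Acyclic := by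
  intro n
  rw [exactAt_iff' _ (n - 1) n (n + 1) (by simp) (by simp), ShortComplex.exact_iff_epi_toCycles]
  refine epi_of_detects hP _ (fun i z => ?_)
  obtain ⟨v, hv⟩ := hC i (n - 1) n (n + 1) (by simp) rfl
    (z ≫ (C.sc' (n - 1) n (n + 1)).iCycles) (by
      refine (Category.assoc _ _ _).trans ((congrArg (z ≫ ·) ?_).trans comp_zero)
      exact (C.sc' (n - 1) n (n + 1)).iCycles_g)
  refine ⟨v, ?_⟩
  rw [← cancel_mono (C.sc' (n - 1) n (n + 1)).iCycles]
  exact (Category.assoc _ _ _).trans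
    ((congrArg (v ≫ ·) (C.sc' (n - 1) n (n + 1)).toCycles_i).trans hv)

lemma epi_of_rlp_cells (hP : Detects P) {X Y : CochainComplex B ℤ} (f : X ⟶ Y)
    (hf : (cells P).rlp f) : Epi f := by
  rw [rlp_cells_iff] at hf
  refine epi_of_epi_f _ (fun n => epi_of_detects hP _ (fun i w => ?_))
  -- The lifting property is used twice: the cocycle `w ≫ d` lifts to a cocycle `v`, and then `w`
  -- lifts to an element with differential `v`.
  obtain ⟨v, hv₁, hv₂⟩ := hf i (n + 1) (n + 2) (n + 3) (by lia) (by lia) 0 (w ≫ Y.d n (n + 1))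
    (by simp) (by simp)
  obtain ⟨u, -, hu⟩ := hf i n (n + 1) (n + 2) rfl (by lia) v w hv₁ hv₂.symm
  exact ⟨u, hu⟩

lemma quasiIso_of_rlp_cells (hP : Detects P) {X Y : CochainComplex B ℤ} (f : X ⟶ Y)
    (hf : (cells P).rlp f) : QuasiIso f := by
  have := epi_of_rlp_cells hP f hf
  rw [rlp_cells_iff] at hf
  have hS : (ShortComplex.mk _ _ (kernel.condition f)).ShortExact :=
    { exact := ShortComplex.exact_of_f_is_kernel _ (kernelIsKernel f)
      mono_f := inferInstanceAs (Mono (kernel.ι f))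
      epi_g := this }
  refine hS.quasiIso_g (acyclic_of_homAcyclic hP (fun i n m k hn hm z hz => ?_))
    (fun j => ⟨j + 1, rfl⟩)
  let k' (n : ℤ) := isLimitForkMapOfIsLimit' (eval B (ComplexShape.up ℤ) n) (kernel.condition f)
    (kernelIsKernel f)
  -- Lifting the zero element of `Y` forces the element that bounds `z` into the kernel of `f`.
  obtain ⟨v, hv₁, hv₂⟩ := hf i n m k hn hm (z ≫ (kernel.ι f).f m) 0
    (by rw [Category.assoc, (kernel.ι f).comm, reassoc_of% hz, zero_comp]) (by
      rw [zero_comp, Category.assoc, ← comp_f, kernel.condition, zero_f, comp_zero])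
  obtain ⟨y, hy⟩ : ∃ y : P i ⟶ (kernel f).X n, y ≫ (kernel.ι f).f n = v :=
    let ⟨y, hy⟩ := KernelFork.IsLimit.lift' (k' n) v hv₂
    ⟨y, hy⟩
  have : Mono ((kernel.ι f).f m) := inferInstance
  refine ⟨y, ?_⟩
  have h : (y ≫ (kernel f).d n m) ≫ (kernel.ι f).f m = z ≫ (kernel.ι f).f m := by
    rw [Category.assoc, ← (kernel.ι f).comm, reassoc_of% hy, hv₁]
  exact (cancel_mono ((kernel.ι f).f m)).1 h

open scoped ZeroObject in
/-- The existence of cellular resolutions. -/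
lemma exists_quasiIso_isCellular [IsGrothendieckAbelian.{v} B] (hP : Detects P)
    (X : CochainComplex B ℤ) :
    ∃ (K : CochainComplex B ℤ) (ρ : K ⟶ X), IsCellular P K ∧ QuasiIso ρ := by
  have := IsGrothendieckAbelian.hasSmallObjectArgument (cells P) (cells_le_monomorphisms P)
  let fac := (functorialFactorizationData (cells P).rlp.llp
    (cells P).rlp).factorizationData (0 : 0 ⟶ X)
  refine ⟨fac.Z, fac.p, ?_, quasiIso_of_rlp_cells hP _ fac.hp⟩
  rw [IsCellular, (isZero_zero _).eq_of_src 0 fac.i]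
  exact fac.hi

/-- The members of `E` that cover one separator already detect zero morphisms; they form a small
family, as the small object argument requires. -/
lemma exists_detects [IsGrothendieckAbelian.{v} B] {E : ObjectProperty B}
    (hE : IsGeneratedBy E) :
    ∃ (ι : Type v) (P : ι → B), (∀ i, E (P i)) ∧ Detects P := by
  obtain ⟨ι, P, c, hc, p, h, _⟩ := hE (separator B)
  refine ⟨ι, P, h, fun X Y g hg => (isSeparator_separator B).def _ _ (fun s => ?_)⟩
  rw [comp_zero, ← cancel_epi p, comp_zero]
  exact hc.hom_ext (fun ⟨i⟩ => by
    simpa only [Category.assoc, comp_zero] using hg i (c.ι.app ⟨i⟩ ≫ p ≫ s))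

end

end CochainComplex
end

/-! ### From BC-admissible objects to maps out of cellular complexes. -/

noncomputable section

namespace CategoryTheory

open Pretriangulated

/-- The maps from `W` to `X` and to `Y` are in bijection via `f`. -/
def HomBijective {T : Type*} [Category* T] (W : T) {X Y : T} (f : X ⟶ Y) : Prop :=
  Function.Bijective (fun g : W ⟶ X => g ≫ f)

namespace HomBijective

variable {T : Type*} [Category* T]

lemma of_iso_left {W W' X Y : T} (e : W ≅ W') {f : X ⟶ Y} (h : HomBijective W f) :
    HomBijective W' f := by
  refine ⟨fun a b hab => ?_, fun c => ?_⟩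
  · rw [← cancel_epi e.hom]
    apply h.1
    dsimp only at hab ⊢
    rw [Category.assoc, Category.assoc, hab]
  · obtain ⟨g, hg⟩ := h.2 (e.hom ≫ c)
    refine ⟨e.inv ≫ g, ?_⟩
    dsimp only at hg ⊢
    rw [Category.assoc, hg, Iso.inv_hom_id_assoc]

lemma of_iso_right {W X Y X' Y' : T} {f : X ⟶ Y} {f' : X' ⟶ Y'} (e : X ≅ X') (e' : Y ≅ Y')
    (w : f ≫ e'.hom = e.hom ≫ f') (h : HomBijective W f) : HomBijective W f' := by
  refine ⟨fun a b hab => ?_, fun c => ?_⟩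
  · rw [← cancel_mono e.inv]
    apply h.1
    dsimp only at hab ⊢
    rw [← cancel_mono e'.hom]
    simp only [Category.assoc, w, Iso.inv_hom_id_assoc, hab]
  · obtain ⟨g, hg⟩ := h.2 (c ≫ e'.inv)
    refine ⟨g ≫ e.hom, ?_⟩
    dsimp only at hg ⊢
    rw [Category.assoc, ← w, reassoc_of% hg, Iso.inv_hom_id, Category.comp_id]

lemma of_isIso_comp {W X Y Z : T} (a : X ⟶ Y) [IsIso a] {b : Y ⟶ Z}
    (h : HomBijective W (a ≫ b)) : HomBijective W b :=
  h.of_iso_right (asIso a) (Iso.refl _) (by simp)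

lemma of_natIso {S : Type*} [Category* S] (F : S ⥤ T) {Φ : S ⥤ S} (e : Φ ≅ 𝟭 S) {X Y : S}
    {f : X ⟶ Y} {W : T} (h : HomBijective W (F.map (Φ.map f))) : HomBijective W (F.map f) :=
  h.of_iso_right (F.mapIso (e.app X)) (F.mapIso (e.app Y))
    ((F.map_comp _ _).symm.trans ((congrArg F.map (e.hom.naturality f)).trans (F.map_comp _ _)))

lemma of_map_shift {S : Type*} [Category* S] [HasShift S ℤ] [HasShift T ℤ] (F : S ⥤ T)
    [F.CommShift ℤ] {X Y : S} {f : X ⟶ Y} {W : T} (n : ℤ) (h : HomBijective W (F.map (f⟦n⟧'))) :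
    HomBijective W ((F.map f)⟦n⟧') :=
  h.of_iso_right ((F.commShiftIso n).app X) ((F.commShiftIso n).app Y)
    (F.commShiftIso_hom_naturality f n)

lemma shift_iff [HasShift T ℤ] {W X Y : T} {f : X ⟶ Y} (n m : ℤ) (h : n + m = 0) :
    HomBijective W (f⟦m⟧') ↔ HomBijective (W⟦n⟧) f := by
  let adj := (shiftEquiv' T n m h).toAdjunction
  have e : (adj.homEquiv W Y) ∘ (fun g : W⟦n⟧ ⟶ X => g ≫ f) =
      (fun g : W ⟶ X⟦m⟧ => g ≫ f⟦m⟧') ∘ adj.homEquiv W X :=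
    funext (fun g => adj.homEquiv_naturality_right g f)
  exact (Function.Bijective.of_comp_iff _ (adj.homEquiv W X).bijective).symm.trans
    (e ▸ Function.Bijective.of_comp_iff' (adj.homEquiv W Y).bijective _)

lemma eq_zero_of_distTriang [Preadditive T] [HasZeroObject T] [HasShift T ℤ]
    [∀ n : ℤ, (shiftFunctor T n).Additive] [Pretriangulated T] {S : Triangle T}
    (hS : S ∈ distTriang T) {W : T} (h₀ : HomBijective W S.mor₁)
    (h₁ : HomBijective W (S.mor₁⟦(1 : ℤ)⟧')) (f : W ⟶ S.obj₃) : f = 0 := by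
  have hf : f ≫ S.mor₃ = 0 := h₁.1 (by
    dsimp only
    rw [Category.assoc, comp_distTriang_mor_zero₃₁ _ hS, comp_zero, zero_comp])
  obtain ⟨g, rfl⟩ := Triangle.coyoneda_exact₃ _ hS f hf
  obtain ⟨g, rfl⟩ := h₀.2 g
  dsimp only
  rw [Category.assoc, comp_distTriang_mor_zero₁₂ _ hS, comp_zero]

lemma of_distTriang [Preadditive T] [HasZeroObject T] [HasShift T ℤ]
    [∀ n : ℤ, (shiftFunctor T n).Additive] [Pretriangulated T] {S : Triangle T}
    (hS : S ∈ distTriang T) {W : T} (h₀ : ∀ f : W ⟶ S.obj₃, f = 0)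
    (h₁ : ∀ f : W⟦(1 : ℤ)⟧ ⟶ S.obj₃, f = 0) : HomBijective W S.mor₁ := by
  refine ⟨fun f f' h => ?_, fun f => ?_⟩
  · rw [← sub_eq_zero]
    apply (shiftFunctor T (1 : ℤ)).map_injective
    obtain ⟨g, hg⟩ := Triangle.coyoneda_exact₁ _ hS ((f - f')⟦(1 : ℤ)⟧') (by
      dsimp only at h
      rw [← Functor.map_comp, Preadditive.sub_comp, h, sub_self, Functor.map_zero])
    rw [hg, h₁ g, zero_comp, Functor.map_zero]
  · obtain ⟨g, hg⟩ := Triangle.coyoneda_exact₂ _ hS f (h₀ _)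
    exact ⟨g, hg.symm⟩

end HomBijective

end CategoryTheory

namespace CochainComplex

open HomologicalComplex

section

variable {B : Type u} [Category.{v} B] [Abelian B]

lemma HomAcyclic.shift {P : B} {C : CochainComplex B ℤ} (hC : HomAcyclic P C) (a : ℤ) :
    HomAcyclic P (C⟦a⟧) := by
  intro n m k hn hm z hz
  have h (x y : ℤ) : (C⟦a⟧).d x y = C.d (x + a) (y + a) ∨
      (C⟦a⟧).d x y = -C.d (x + a) (y + a) := by
    obtain h | h := Int.units_eq_one_or a.negOnePow
    · exact Or.inl ((congrArg (· • C.d (x + a) (y + a)) h).trans (one_smul _ _))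
    · exact Or.inr ((congrArg (· • C.d (x + a) (y + a)) h).trans (by simp))
  obtain ⟨v, hv⟩ := hC (n + a) (m + a) (k + a) (by lia) (by lia) z (by
    obtain h | h := h m k
    · rwa [h] at hz
    · rw [h] at hz
      exact neg_eq_zero.1 ((Preadditive.comp_neg _ _).symm.trans hz))
  obtain h | h := h n m
  · exact ⟨v, h ▸ hv⟩
  · refine ⟨-v, ?_⟩
    rw [h]
    exact (Preadditive.neg_comp_neg _ _).trans hv

lemma homAcyclic_of_hom_eq_zero {P : B} {C : CochainComplex B ℤ}
    (hC : ∀ (n : ℤ) (f : (single B (ComplexShape.up ℤ) n).obj P ⟶ C), Nonempty (Homotopy f 0)) :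
    HomAcyclic P C := by
  rintro n m k rfl rfl z hz
  obtain ⟨h⟩ := hC (n + 1) (mkHomFromSingle z (by rintro _ rfl; exact hz))
  refine ⟨(singleObjXSelf _ _ _).inv ≫ h.hom (n + 1) n, ?_⟩
  have := h.comm (n + 1)
  rw [dNext_eq _ (up_rel (n + 1)), prevD_eq _ (up_rel n), single_obj_d, zero_comp, zero_add,
    zero_f, add_zero, mkHomFromSingle_f] at this
  rw [Category.assoc, ← this, Iso.inv_hom_id_assoc]

end

variable {A : Type u₁} [Category.{v} A] [Abelian A] {B : Type u₂} [Category.{v} B] [Abelian B]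
  (G : A ⥤ B) [G.Additive]


variable (B) in
/-- The functor from complexes to the homotopy category. -/
abbrev toHo : CochainComplex B ℤ ⥤ HomotopyCategory B (ComplexShape.up ℤ) :=
  HomotopyCategory.quotient B (ComplexShape.up ℤ)

lemma homBijective_shift_of_isBCAdmissible {X : CochainComplex B ℤ} (hX : IsBCAdmissible G X)
    {I : CochainComplex A ℤ} {J : CochainComplex B ℤ} (j : (mapCh G).obj I ⟶ J)
    (hI : I.IsKInjective) (hJ : J.IsKInjective) (hj : QuasiIso j) (m : ℤ) :
    HomBijective (((toHo B).obj X)⟦m⟧) ((toHo B).map j) := by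
  -- Admissibility at `n = 0` is enough, since `I` and `J` may be replaced by arbitrary shifts; this
  -- also gives the shifts of the sign that `n : ℕ` omits.
  have h := hX (I⟦-m⟧) (J⟦-m⟧) (((mapCh G).commShiftIso (-m)).hom.app I ≫ j⟦-m⟧')
    inferInstance inferInstance inferInstance 0
  rw [← HomBijective.shift_iff m (-m) (by lia)]
  have h' : HomBijective ((toHo B).obj X)
      ((toHo B).map (((mapCh G).commShiftIso (-m)).hom.app I ≫ j⟦-m⟧')) :=
    HomBijective.of_natIso _ (CategoryTheory.shiftFunctorZero' _ (-((0 : ℕ) : ℤ)) (by simp)) h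
  rw [Functor.map_comp] at h'
  exact HomBijective.of_map_shift _ _ (h'.of_isIso_comp _)

lemma homAcyclic_mappingCone_of_isBCAdmissible {P : B}
    (hP : IsBCAdmissible G ((single B (ComplexShape.up ℤ) 0).obj P))
    {I : CochainComplex A ℤ} {J : CochainComplex B ℤ} (j : (mapCh G).obj I ⟶ J)
    (hI : I.IsKInjective) (hJ : J.IsKInjective) (hj : QuasiIso j) :
    HomAcyclic P (mappingCone j) := by
  refine homAcyclic_of_hom_eq_zero (fun n f => ⟨HomotopyCategory.homotopyOfEq _ _ ?_⟩)
  rw [Functor.map_zero]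
  let e : ((toHo B).obj ((single B (ComplexShape.up ℤ) 0).obj P))⟦-n⟧ ≅
      (toHo B).obj ((single B (ComplexShape.up ℤ) n).obj P) :=
    ((toHo B).commShiftIso (-n)).symm.app _ ≪≫
      (toHo B).mapIso (((singleFunctors B).shiftIso (-n) n 0 (by lia)).app P)
  have h (m : ℤ) := homBijective_shift_of_isBCAdmissible G hP j hI hJ hj m
  exact HomBijective.eq_zero_of_distTriang (HomotopyCategory.mappingCone_triangleh_distinguished j)
    ((h (-n)).of_iso_left e)
    ((HomBijective.shift_iff (-1) 1 (by simp)).2 (HomBijective.of_iso_left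
      (e := (CategoryTheory.shiftFunctorAdd' _ (-n) (-1) _ rfl).app _ ≪≫
        (CategoryTheory.shiftFunctor _ (-1)).mapIso e) (h (-n + -1)))) _

/-- The cone of `j` is acyclic as seen by each `P i`, so it and its shifts receive only
null-homotopic maps from `K`. The long exact sequence of the triangle of `j` then gives bijectivity.
-/
lemma IsCellular.homBijective {ι : Type v} {P : ι → B}
    (hP : ∀ i, IsBCAdmissible G ((single B (ComplexShape.up ℤ) 0).obj (P i)))
    {K : CochainComplex B ℤ} (hK : IsCellular P K)
    {I : CochainComplex A ℤ} {J : CochainComplex B ℤ} (j : (mapCh G).obj I ⟶ J)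
    (hI : I.IsKInjective) (hJ : J.IsKInjective) (hj : QuasiIso j) :
    HomBijective ((toHo B).obj K) ((toHo B).map j) := by
  have hC (i : ι) := homAcyclic_mappingCone_of_isBCAdmissible G (hP i) j hI hJ hj
  have h {C : CochainComplex B ℤ} (hC : ∀ i, HomAcyclic (P i) C)
      (f : (toHo B).obj K ⟶ (toHo B).obj C) : f = 0 := by
    obtain ⟨f, rfl⟩ := (toHo B).map_surjective f
    obtain ⟨h⟩ := hK.nonempty_homotopy_zero hC f
    rw [HomotopyCategory.eq_of_homotopy f 0 h, Functor.map_zero]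
  refine HomBijective.of_distTriang (HomotopyCategory.mappingCone_triangleh_distinguished j)
    (h hC) (fun f => ?_)
  have aux {X Y Z W : HomotopyCategory B (ComplexShape.up ℤ)} (a : X ≅ Y) (g : Y ⟶ Z) (b : Z ≅ W)
      (h : a.hom ≫ g ≫ b.hom = 0) : g = 0 := by
    rw [← cancel_mono b.hom, ← cancel_epi a.hom, h, zero_comp, comp_zero]
  apply (CategoryTheory.shiftFunctor _ (-1 : ℤ)).map_injective
  rw [Functor.map_zero]
  exact aux ((CategoryTheory.shiftFunctorCompIsoId _ (1 : ℤ) (-1) (by simp)).symm.app _) _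
    (((toHo B).commShiftIso (-1)).symm.app _) (h (fun i => (hC i).shift (-1)) _)

section

attribute [local instance] HasDerivedCategory.standard

/-- Take a K-injective replacement `J` of `Ch(G)(I)`. Homotopy classes of maps from `K` to
`Ch(G)(I)` and to `J` agree by cellularity, those to `J` are maps in the derived category, and there
the two targets are isomorphic. -/
lemma IsCellular.bijective_Qh_map [IsGrothendieckAbelian.{v} B] {ι : Type v} {P : ι → B}
    (hP : ∀ i, IsBCAdmissible G ((single B (ComplexShape.up ℤ) 0).obj (P i)))
    {K : CochainComplex B ℤ} (hK : IsCellular P K) {I : CochainComplex A ℤ}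
    (hI : I.IsKInjective) :
    Function.Bijective (DerivedCategory.Qh.map :
      ((toHo B).obj K ⟶ (toHo B).obj ((mapCh G).obj I)) → _) := by
  obtain ⟨J, j, hJ, hj⟩ := exists_quasiIso_isKInjective ((mapCh G).obj I)
  have : IsIso (DerivedCategory.Qh.map ((toHo B).map j)) :=
    (NatIso.isIso_map_iff (DerivedCategory.quotientCompQhIso B) j).2 inferInstance
  have h := (IsKInjective.Qh_map_bijective ((toHo B).obj K) J).comp
    (hK.homBijective G hP j hI hJ hj)
  refine (Function.Bijective.of_comp_iff' (f := fun g => g ≫ DerivedCategory.Qh.map ((toHo B).map j))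
    ?_ _).1 ?_
  · exact ⟨fun a b h => (cancel_mono _).1 h,
      fun b => ⟨b ≫ inv (DerivedCategory.Qh.map ((toHo B).map j)), by simp⟩⟩
  · convert h using 1
    ext g
    simp

lemma IsCellular.exists_Q_map_eq [IsGrothendieckAbelian.{v} B] {ι : Type v} {P : ι → B}
    (hP : ∀ i, IsBCAdmissible G ((single B (ComplexShape.up ℤ) 0).obj (P i)))
    {K : CochainComplex B ℤ} (hK : IsCellular P K) {I : CochainComplex A ℤ}
    (hI : I.IsKInjective)
    (f : DerivedCategory.Q.obj K ⟶ DerivedCategory.Q.obj ((mapCh G).obj I)) :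
    ∃ g : K ⟶ (mapCh G).obj I, DerivedCategory.Q.map g = f := by
  let e := DerivedCategory.quotientCompQhIso B
  obtain ⟨g, hg⟩ := (hK.bijective_Qh_map G hP hI).2 (e.hom.app _ ≫ f ≫ e.inv.app _)
  obtain ⟨g, rfl⟩ := (toHo B).map_surjective g
  refine ⟨g, ?_⟩
  have := e.hom.naturality g
  rw [← cancel_epi (e.hom.app _)]
  refine this.symm.trans ?_
  refine (congrArg (· ≫ _) hg).trans ?_
  simp [e]

lemma IsCellular.nonempty_homotopy [IsGrothendieckAbelian.{v} B] {ι : Type v} {P : ι → B}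
    (hP : ∀ i, IsBCAdmissible G ((single B (ComplexShape.up ℤ) 0).obj (P i)))
    {K : CochainComplex B ℤ} (hK : IsCellular P K) {I : CochainComplex A ℤ}
    (hI : I.IsKInjective) (f g : K ⟶ (mapCh G).obj I)
    (h : DerivedCategory.Q.map f = DerivedCategory.Q.map g) : Nonempty (Homotopy f g) := by
  let e := DerivedCategory.quotientCompQhIso B
  refine ⟨HomotopyCategory.homotopyOfEq _ _ ((hK.bijective_Qh_map G hP hI).1 ?_)⟩
  have hf := e.hom.naturality f
  have hg := e.hom.naturality g
  rw [h] at hf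
  exact (cancel_mono _).1 (hf.trans hg.symm)

end

end CochainComplex
end

/-! ### The pro-left adjoint of `D(G)`. -/

noncomputable section

variable {A : Type u₁} [Category.{v} A] {B : Type u₂} [Category.{v} B] [Abelian A] [Abelian B]

section

attribute [local instance] HasDerivedCategory.standard

namespace HoDiag

variable {I : Type v} [SmallCategory I]

lemma eval_comp {D D' D'' : I ⥤ CochainComplex B ℤ}
    (η : (levelwiseQuasiIso I B).Q.obj D ⟶ (levelwiseQuasiIso I B).Q.obj D')
    (η' : (levelwiseQuasiIso I B).Q.obj D' ⟶ (levelwiseQuasiIso I B).Q.obj D'') (i : I) :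
    eval (η ≫ η') i = eval η i ≫ eval η' i := by
  simp only [eval, Functor.map_comp, Category.assoc, Iso.hom_inv_id_app_assoc]

lemma eval_Q_map {D D' : I ⥤ CochainComplex B ℤ} (f : D ⟶ D') (i : I) :
    eval ((levelwiseQuasiIso I B).Q.map f) i = DerivedCategory.Q.map (f.app i) := by
  let e := Localization.fac _ (evaluation_comp_Q_inverts (B := B) I i) (levelwiseQuasiIso I B).Q
  exact ((e.app D).inv_comp_eq).2 (e.hom.naturality f)

end HoDiag

section

variable (G : A ⥤ B) [G.Additive] [PreservesFiniteLimits G] [PreservesFiniteColimits G]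

lemma mapDerived_comp {K L M : CochainComplex A ℤ}
    (f : DerivedCategory.Q.obj K ⟶ DerivedCategory.Q.obj L)
    (g : DerivedCategory.Q.obj L ⟶ DerivedCategory.Q.obj M) :
    mapDerived G (f ≫ g) = mapDerived G f ≫ mapDerived G g := by
  simp only [mapDerived, Functor.map_comp, Category.assoc, Iso.hom_inv_id_app_assoc]

lemma mapDerived_Q_map {K L : CochainComplex A ℤ} (f : K ⟶ L) :
    mapDerived G (DerivedCategory.Q.map f) = DerivedCategory.Q.map ((mapCh G).map f) := by
  exact ((G.mapDerivedCategoryFactors.app K).inv_comp_eq).2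
    (G.mapDerivedCategoryFactors_hom_naturality f)

end

lemma CochainComplex.IsKInjective.exists_Q_map_eq {K L : CochainComplex A ℤ}
    (hL : L.IsKInjective) (f : DerivedCategory.Q.obj K ⟶ DerivedCategory.Q.obj L) :
    ∃ g : K ⟶ L, DerivedCategory.Q.map g = f := by
  let e := DerivedCategory.quotientCompQhIso A
  obtain ⟨g, hg⟩ := (CochainComplex.IsKInjective.Qh_map_bijective _ L).2
    (e.hom.app _ ≫ f ≫ e.inv.app _)
  obtain ⟨g, rfl⟩ := (CochainComplex.toHo A).map_surjective g
  refine ⟨g, ?_⟩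
  rw [← cancel_epi (e.hom.app _)]
  refine (e.hom.naturality g).symm.trans ?_
  refine (congrArg (· ≫ _) hg).trans ?_
  simp [e]

instance [IsGrothendieckAbelian.{v} A] (G : A ⥤ B) [G.Additive]
    [PreservesFilteredColimitsOfSize.{v, v} G] :
    PreservesFilteredColimitsOfSize.{v, v} (mapCh G) :=
  ⟨fun _ _ _ => inferInstance⟩

section

variable (G : A ⥤ B) [G.Additive]
  {I : Type v} [SmallCategory I] {K : I ⥤ CochainComplex A ℤ}
  {P : CochainComplex B ℤ} (η : (Functor.const I).obj P ⟶ K ⋙ mapCh G)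

variable {G} in
lemma const_app_comp_map {i j : I} (t : i ⟶ j) :
    (η.app i : P ⟶ (mapCh G).obj (K.obj i)) ≫ (mapCh G).map (K.map t) = η.app j :=
  (η.naturality t).symm.trans (Category.id_comp _)

variable {G} {η} in
-- A homotopy is a map from `P` to the path object of `Ch(G)(L)`, which is `Ch(G)` of the path
-- object of `L`. This map factors through some `K k`, and over a further index it becomes a
-- homotopy between `φ` and `φ'`.
lemma exists_Q_map_eq_of_homotopy [IsCofiltered I]
    (hη : ∀ (Y) (f : P ⟶ (mapCh G).obj Y), ∃ (i : I) (φ : K.obj i ⟶ Y),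
      η.app i ≫ (mapCh G).map φ = f)
    (hη' : ∀ (i : I) (Y) (φ φ' : K.obj i ⟶ Y),
      η.app i ≫ (mapCh G).map φ = η.app i ≫ (mapCh G).map φ' →
        ∃ (i' : I) (t : i' ⟶ i), K.map t ≫ φ = K.map t ≫ φ')
    {L : CochainComplex A ℤ} {i : I} (φ φ' : K.obj i ⟶ L)
    (h : Homotopy ((η.app i : P ⟶ (mapCh G).obj (K.obj i)) ≫ (mapCh G).map φ)
      ((η.app i : P ⟶ (mapCh G).obj (K.obj i)) ≫ (mapCh G).map φ')) :
    ∃ (i' : I) (t : i' ⟶ i),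
      DerivedCategory.Q.map (K.map t ≫ φ) = DerivedCategory.Q.map (K.map t ≫ φ') := by
  have hc : ∀ n : ℤ, ∃ m, (ComplexShape.up ℤ).Rel n m := fun n => ⟨n + 1, rfl⟩
  obtain ⟨k, ψ, hψ⟩ := hη L.pathObject (HomologicalComplex.pathObject.lift _ _ h ≫
    (HomologicalComplex.pathObject.mapHomologicalComplexObjIso L G hc).inv)
  have h₀ : (η.app k : P ⟶ (mapCh G).obj (K.obj k)) ≫
      (mapCh G).map (ψ ≫ HomologicalComplex.pathObject.π₀ L) = η.app i ≫ (mapCh G).map φ := by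
    rw [Functor.map_comp, reassoc_of% hψ,
      HomologicalComplex.pathObject.mapHomologicalComplexObjIso_inv_map_π₀,
      HomologicalComplex.pathObject.lift_π₀]
  have h₁ : (η.app k : P ⟶ (mapCh G).obj (K.obj k)) ≫
      (mapCh G).map (ψ ≫ HomologicalComplex.pathObject.π₁ L) = η.app i ≫ (mapCh G).map φ' := by
    rw [Functor.map_comp, reassoc_of% hψ,
      HomologicalComplex.pathObject.mapHomologicalComplexObjIso_inv_map_π₁,
      HomologicalComplex.pathObject.lift_π₁]
  -- Maps with the same restriction to `P` agree over a further index; this is applied to both ends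
  -- of the path `ψ`.
  have key (α : K.obj k ⟶ L) (β : K.obj i ⟶ L)
      (hαβ : (η.app k : P ⟶ (mapCh G).obj (K.obj k)) ≫ (mapCh G).map α =
        η.app i ≫ (mapCh G).map β) (j : I) (s : j ⟶ k) (t : j ⟶ i) :
      ∃ (j' : I) (r : j' ⟶ j), K.map (r ≫ s) ≫ α = K.map (r ≫ t) ≫ β := by
    obtain ⟨j', r, hr⟩ := hη' j _ (K.map s ≫ α) (K.map t ≫ β) (by
      refine (congrArg _ ((mapCh G).map_comp _ _)).trans (Eq.trans ?_
        (congrArg _ ((mapCh G).map_comp _ _)).symm)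
      refine (Category.assoc _ _ _).symm.trans (Eq.trans ?_ (Category.assoc _ _ _))
      rw [const_app_comp_map]
      exact hαβ.trans (congrArg (· ≫ _) (const_app_comp_map η t).symm))
    exact ⟨j', r, by simpa using hr⟩
  obtain ⟨j, r, hr⟩ := key _ _ h₀ _ (IsCofiltered.minToLeft k i) (IsCofiltered.minToRight k i)
  obtain ⟨j', r', hr'⟩ := key _ _ h₁ j (r ≫ IsCofiltered.minToLeft k i)
    (r ≫ IsCofiltered.minToRight k i)
  refine ⟨j', r' ≫ r ≫ IsCofiltered.minToRight k i, ?_⟩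
  rw [← hr', Functor.map_comp K r', Category.assoc, ← hr]
  refine DerivedCategory.Q_map_eq_of_homotopy _ (Homotopy.trans (Homotopy.ofEq ?_)
    (((HomologicalComplex.pathObject.homotopy₀₁ L hc).compLeft
      (K.map (r' ≫ r ≫ IsCofiltered.minToLeft k i) ≫ ψ)).trans (Homotopy.ofEq ?_)))
  · simp
  · simp

end

/-- If `B` is generated by BC-admissible objects, the derived functor of `G` has a pro-left
adjoint. -/
lemma nonempty_derivedProLeftAdjoint [IsGrothendieckAbelian.{v} A] [IsGrothendieckAbelian.{v} B]
    (G : A ⥤ B) [G.Additive] [PreservesFiniteLimits G] [PreservesFiniteColimits G]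
    [PreservesFilteredColimitsOfSize.{v, v} G]
    (E : ObjectProperty B) (hE : IsGeneratedBy E)
    (hadm : ∀ P : B, E P →
      IsBCAdmissible G ((HomologicalComplex.single B (ComplexShape.up ℤ) 0).obj P)) :
    Nonempty (DerivedProLeftAdjoint G) := by
  refine ⟨fun X => Classical.choice ?_⟩
  obtain ⟨ι, P, hEP, hP⟩ := CochainComplex.exists_detects hE
  replace hEP := fun i => hadm _ (hEP i)
  obtain ⟨M, ρ, hM, hρ⟩ := CochainComplex.exists_quasiIso_isCellular hP X
  -- The cone is universal for strict maps of complexes out of `M`; cellularity of `M` makes it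
  -- universal in the derived category.
  obtain ⟨I, _, _, K, η, hη, hη'⟩ :=
    exists_cofiltered_cone (mapCh G) M (exists_solutionSet (mapCh G) M)
  have : IsIso ((levelwiseQuasiIso I B).Q.map ((Functor.const I).map ρ)) :=
    (levelwiseQuasiIso I B).Q_inverts _ (fun _ => hρ)
  let unit := inv ((levelwiseQuasiIso I B).Q.map ((Functor.const I).map ρ)) ≫
    (levelwiseQuasiIso I B).Q.map η
  have hunit (i : I) : DerivedCategory.Q.map ρ ≫ HoDiag.eval unit i =
      DerivedCategory.Q.map (η.app i) := by
    have : (levelwiseQuasiIso I B).Q.map ((Functor.const I).map ρ) ≫ unit =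
      (levelwiseQuasiIso I B).Q.map η := IsIso.hom_inv_id_assoc _ _
    have h := congrArg (fun t => HoDiag.eval t i) this
    rw [HoDiag.eval_comp, HoDiag.eval_Q_map, HoDiag.eval_Q_map] at h
    exact h
  have hunit' (i : I) {L : CochainComplex A ℤ} (φ : K.obj i ⟶ L) :
      DerivedCategory.Q.map ρ ≫ HoDiag.eval unit i ≫ mapDerived G (DerivedCategory.Q.map φ) =
      DerivedCategory.Q.map ((η.app i : M ⟶ (mapCh G).obj (K.obj i)) ≫ (mapCh G).map φ) := by
    rw [mapDerived_Q_map, Functor.map_comp, ← Category.assoc]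
    exact congrArg (· ≫ _) (hunit i)
  have hiso {Y L : CochainComplex A ℤ} (y : Y ⟶ L) (hy : QuasiIso y) :
      IsIso (mapDerived G (DerivedCategory.Q.map y)) := by
    unfold mapDerived
    infer_instance
  refine ⟨⟨I, K, unit, fun Y f => ?_, fun Y i g g' h => ?_⟩⟩
  -- With `Y` replaced by a K-injective `L`, the morphism is represented by a strict map from `M`,
  -- which factors through the cone.
  · obtain ⟨L, y, hL, hy⟩ := CochainComplex.exists_quasiIso_isKInjective Y
    have := hiso y hy
    obtain ⟨g, hg⟩ := hM.exists_Q_map_eq G hEP hL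
      (DerivedCategory.Q.map ρ ≫ f ≫ mapDerived G (DerivedCategory.Q.map y))
    obtain ⟨i, φ, hφ⟩ := hη _ g
    refine ⟨i, DerivedCategory.Q.map φ ≫ inv (DerivedCategory.Q.map y), ?_⟩
    rw [← cancel_mono (mapDerived G (DerivedCategory.Q.map y)),
      ← cancel_epi (DerivedCategory.Q.map ρ), ← hg, ← hφ, Category.assoc, ← mapDerived_comp,
      Category.assoc, IsIso.inv_hom_id, Category.comp_id]
    exact hunit' i φ
  -- Into a K-injective `L` both morphisms are strict, and their equality after the unit becomes a
  -- homotopy of maps out of `M`.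
  · obtain ⟨L, y, hL, hy⟩ := CochainComplex.exists_quasiIso_isKInjective Y
    obtain ⟨φ, hφ⟩ := hL.exists_Q_map_eq (g ≫ DerivedCategory.Q.map y)
    obtain ⟨φ', hφ'⟩ := hL.exists_Q_map_eq (g' ≫ DerivedCategory.Q.map y)
    obtain ⟨H⟩ := hM.nonempty_homotopy G hEP hL _ _ ((hunit' i φ).symm.trans (Eq.trans (by
      rw [hφ, hφ', mapDerived_comp, mapDerived_comp, reassoc_of% h]) (hunit' i φ')))
    obtain ⟨i', t, ht⟩ := exists_Q_map_eq_of_homotopy hη hη' φ φ' H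
    refine ⟨i', t, ?_⟩
    rw [← cancel_mono (DerivedCategory.Q.map y), Category.assoc, Category.assoc, ← hφ, ← hφ',
      ← Functor.map_comp, ht, Functor.map_comp]

end

end

/-! ### Comparison of `π₀` of `LF` with `F`. -/

noncomputable section

variable {A : Type u₁} [Category.{v} A] {B : Type u₂} [Category.{v} B] [Abelian A] [Abelian B]

/-- The value of a pro-left adjoint at `X` is determined by a universal cone. -/
lemma ProLeftAdjoint.exists_formalLim_iso {A : Type u₁} [Category.{v} A] {B : Type u₂}
    [Category.{v} B] {G : A ⥤ B} (F : ProLeftAdjoint G) (X : B) {I : Type v} [SmallCategory I]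
    [IsCofiltered I] (D : I ⥤ A) (κ : ∀ i, X ⟶ G.obj (D.obj i))
    (hκ : ∀ ⦃i j⦄ (φ : i ⟶ j), κ i ≫ G.map (D.map φ) = κ j)
    (surj : ∀ ⦃Y⦄ (f : X ⟶ G.obj Y), ∃ (i : I) (u : D.obj i ⟶ Y), κ i ≫ G.map u = f)
    (inj : ∀ ⦃i Y⦄ (u u' : D.obj i ⟶ Y), κ i ≫ G.map u = κ i ≫ G.map u' →
      ∃ (i' : I) (φ : i' ⟶ i), D.map φ ≫ u = D.map φ ≫ u') :
    ∃ e : ProCat.formalLim D ≅ F.functor.obj X,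
      ∀ i, F.homEquiv X _ (e.inv ≫ ProCat.proj D i) = κ i := by
  obtain ⟨l, hl⟩ := ProCat.exists_lift (D := D)
    (fun i => (F.homEquiv X _).symm (κ i)) (fun i j φ => by
      apply (F.homEquiv X _).injective
      rw [F.homEquiv_naturality_right, Equiv.apply_symm_apply, Equiv.apply_symm_apply, hκ])
  have hl' (i : I) {Y : A} (u : D.obj i ⟶ Y) :
      F.homEquiv X Y (l ≫ ProCat.proj D i ≫ (ProCat.const A).map u) = κ i ≫ G.map u := by
    rw [reassoc_of% hl, F.homEquiv_naturality_right, Equiv.apply_symm_apply]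
  have : IsIso l := ProCat.isIso_of_bijective _ (fun Y => by
    refine ⟨fun g g' h => ?_, fun t => ?_⟩
    · obtain ⟨i, u, rfl⟩ := ProCat.exists_eq_proj_comp g
      obtain ⟨i', u', rfl⟩ := ProCat.exists_eq_proj_comp g'
      have h' := congrArg (F.homEquiv X Y) h
      dsimp only at h'
      rw [hl', hl'] at h'
      let a := IsCofiltered.minToLeft i i'
      let b := IsCofiltered.minToRight i i'
      obtain ⟨k, φ, hφ⟩ := inj (D.map a ≫ u) (D.map b ≫ u') (by
        rw [G.map_comp, G.map_comp, reassoc_of% hκ a, reassoc_of% hκ b, h'])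
      rw [← ProCat.proj_map D a, ← ProCat.proj_map D b, ← ProCat.proj_map D φ]
      simp only [Category.assoc, ← (ProCat.const A).map_comp, hφ]
    · obtain ⟨i, u, hu⟩ := surj (F.homEquiv X Y t)
      exact ⟨ProCat.proj D i ≫ (ProCat.const A).map u,
        (F.homEquiv X Y).injective ((hl' i u).trans hu)⟩)
  refine ⟨(asIso l).symm, fun i => ?_⟩
  rw [Iso.symm_inv, asIso_hom, hl, Equiv.apply_symm_apply]

section

attribute [local instance] HasDerivedCategory.standard

/-- `φ` induces a natural transformation between the evaluations at `i` and `j`, and it descends to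
the localization. -/
lemma HoDiag.eval_naturality {I : Type v} [SmallCategory I] {D D' : I ⥤ CochainComplex B ℤ}
    (η : (levelwiseQuasiIso I B).Q.obj D ⟶ (levelwiseQuasiIso I B).Q.obj D') {i j : I}
    (φ : i ⟶ j) :
    eval η i ≫ DerivedCategory.Q.map (D'.map φ) = DerivedCategory.Q.map (D.map φ) ≫ eval η j := by
  let W := levelwiseQuasiIso I B
  let ev (i : I) := (evaluation I (CochainComplex B ℤ)).obj i ⋙ DerivedCategory.Q
  let lift (i : I) := Localization.lift (ev i) (evaluation_comp_Q_inverts (B := B) I i) W.Q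
  let e (i : I) : W.Q ⋙ lift i ≅ ev i :=
    Localization.fac _ (evaluation_comp_Q_inverts (B := B) I i) W.Q
  let τ : ev i ⟶ ev j :=
    Functor.whiskerRight ((evaluation I (CochainComplex B ℤ)).map φ) DerivedCategory.Q
  let (i : I) : Localization.Lifting W.Q W (ev i) (lift i) := ⟨e i⟩
  let σ : lift i ⟶ lift j := Localization.liftNatTrans W.Q W (ev i) (ev j) _ _ τ
  have hσ (D : I ⥤ CochainComplex B ℤ) : (e i).inv.app D ≫ σ.app (W.Q.obj D) =
      τ.app D ≫ (e j).inv.app D := by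
    refine (congrArg _ (Localization.liftNatTrans_app W.Q W (ev i) (ev j) (lift i) (lift j)
      τ D)).trans ?_
    exact (e i).inv_hom_id_app_assoc D _
  have hσ' (D : I ⥤ CochainComplex B ℤ) : (e i).hom.app D ≫ τ.app D =
      σ.app (W.Q.obj D) ≫ (e j).hom.app D := by
    rw [← cancel_epi ((e i).inv.app D), Iso.inv_hom_id_app_assoc, reassoc_of% hσ,
      Iso.inv_hom_id_app]
    exact (Category.comp_id _).symm
  change ((e i).inv.app D ≫ (lift i).map η ≫ (e i).hom.app D') ≫ τ.app D' =
    τ.app D ≫ (e j).inv.app D ≫ (lift j).map η ≫ (e j).hom.app D'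
  rw [Category.assoc, Category.assoc, hσ', σ.naturality_assoc, reassoc_of% hσ]

namespace DerivedCategory

/-- The map in degree zero homology induced by a morphism in the derived category. -/
def homologyZeroMap {K L : CochainComplex A ℤ} (f : Q.obj K ⟶ Q.obj L) :
    K.homology 0 ⟶ L.homology 0 :=
  (homologyFunctorFactors A 0).inv.app K ≫ (homologyFunctor A 0).map f ≫
    (homologyFunctorFactors A 0).hom.app L

lemma homologyZeroMap_comp {K L M : CochainComplex A ℤ} (f : Q.obj K ⟶ Q.obj L)
    (g : Q.obj L ⟶ Q.obj M) :
    homologyZeroMap (f ≫ g) = homologyZeroMap f ≫ homologyZeroMap g := by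
  have aux {D : Type _} [Category D] (H : D ⥤ A) {U V W : D} {U' V' W' : A} (f : U ⟶ V)
      (g : V ⟶ W) (a : U' ⟶ H.obj U) (e : H.obj V ≅ V') (b : H.obj W ⟶ W') :
      a ≫ H.map (f ≫ g) ≫ b = (a ≫ H.map f ≫ e.hom) ≫ e.inv ≫ H.map g ≫ b := by simp
  exact aux (homologyFunctor A 0) f g _ ((homologyFunctorFactors A 0).app L) _

lemma homologyZeroMap_Q_map {K L : CochainComplex A ℤ} (f : K ⟶ L) :
    homologyZeroMap (Q.map f) = HomologicalComplex.homologyMap f 0 :=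
  (((homologyFunctorFactors A 0).app K).inv_comp_eq).2 (homologyFunctorFactors_hom_naturality f 0)

lemma eq_zero_of_homologyZeroMap_eq_zero {X Y : A}
    (f : Q.obj ((HomologicalComplex.single A (ComplexShape.up ℤ) 0).obj X) ⟶
      Q.obj ((HomologicalComplex.single A (ComplexShape.up ℤ) 0).obj Y))
    (hf : homologyZeroMap f = 0) : f = 0 := by
  obtain ⟨g, hg⟩ : ∃ g : X ⟶ Y,
      Q.map ((HomologicalComplex.single A (ComplexShape.up ℤ) 0).map g) = f :=
    (singleFunctor A 0).map_surjective f
  have h := HomologicalComplex.singleObjHomologySelfIso_inv_naturality (ComplexShape.up ℤ) 0 g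
  rw [← homologyZeroMap_Q_map, hg, hf, comp_zero] at h
  have : g = 0 := by
    rw [← cancel_mono (HomologicalComplex.singleObjHomologySelfIso (ComplexShape.up ℤ) 0 Y).inv,
      ← h, zero_comp]
  rw [← hg, this, Functor.map_zero, Functor.map_zero]

end DerivedCategory

open DerivedCategory

section

variable (G : A ⥤ B) [G.Additive] [PreservesFiniteLimits G] [PreservesFiniteColimits G]

/-- An exact functor commutes with homology. -/
def mapChHomologyIso (K : CochainComplex A ℤ) :
    ((mapCh G).obj K).homology 0 ≅ G.obj (K.homology 0) :=
  (K.sc 0).mapHomologyIso G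

lemma homologyMap_mapChHomologyIso_hom {K L : CochainComplex A ℤ} (f : K ⟶ L) :
    HomologicalComplex.homologyMap ((mapCh G).map f) 0 ≫ (mapChHomologyIso G L).hom =
      (mapChHomologyIso G K).hom ≫ G.map (HomologicalComplex.homologyMap f 0) :=
  ShortComplex.mapHomologyIso_hom_naturality
    ((HomologicalComplex.shortComplexFunctor A (ComplexShape.up ℤ) 0).map f) G

/-- Writing `f` as a fraction with denominator a quasi-isomorphism `s` reduces this to naturality
for maps of complexes, as `s` is invertible on homology. -/
lemma homologyZeroMap_mapDerived {K L : CochainComplex A ℤ} (f : Q.obj K ⟶ Q.obj L) :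
    homologyZeroMap (mapDerived G f) ≫ (mapChHomologyIso G L).hom =
      (mapChHomologyIso G K).hom ≫ G.map (homologyZeroMap f) := by
  obtain ⟨M, g, s, hs, hf⟩ := left_fac f
  have hf' : f ≫ Q.map s = Q.map g := by rw [hf, Category.assoc, IsIso.inv_hom_id, Category.comp_id]
  have : IsIso (HomologicalComplex.homologyMap s 0) := by
    rw [isIso_Q_map_iff_quasiIso] at hs
    infer_instance
  have h₁ := congrArg homologyZeroMap (congrArg (mapDerived G) hf')
  have h₂ := congrArg homologyZeroMap hf'
  rw [mapDerived_comp, mapDerived_Q_map, mapDerived_Q_map, homologyZeroMap_comp,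
    homologyZeroMap_Q_map, homologyZeroMap_Q_map] at h₁
  rw [homologyZeroMap_comp, homologyZeroMap_Q_map, homologyZeroMap_Q_map] at h₂
  rw [← cancel_mono (G.map (HomologicalComplex.homologyMap s 0)), Category.assoc, Category.assoc,
    ← homologyMap_mapChHomologyIso_hom, reassoc_of% h₁, homologyMap_mapChHomologyIso_hom,
    ← G.map_comp, h₂]

/-- Every map from `H⁰ K` to an injective object is induced by a map of complexes. -/
lemma exists_homologyMap_single_eq (K : CochainComplex A ℤ) {J : A} [Injective J]
    (w : K.homology 0 ⟶ J) :
    ∃ f : K ⟶ (HomologicalComplex.single A (ComplexShape.up ℤ) 0).obj J,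
      HomologicalComplex.homologyMap f 0 ≫
        (HomologicalComplex.singleObjHomologySelfIso (ComplexShape.up ℤ) 0 J).hom = w := by
  refine ⟨HomologicalComplex.mkHomToSingle
    (K.pOpcycles 0 ≫ Injective.factorThru w (K.homologyι 0)) (fun i _ => by simp), ?_⟩
  have h : HomologicalComplex.opcyclesMap (HomologicalComplex.mkHomToSingle
      (K.pOpcycles 0 ≫ Injective.factorThru w (K.homologyι 0)) (fun i _ => by simp)) 0 ≫
      (HomologicalComplex.singleObjOpcyclesSelfIso (ComplexShape.up ℤ) 0 J).inv =
      Injective.factorThru w (K.homologyι 0) := by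
    rw [← cancel_epi (K.pOpcycles 0), HomologicalComplex.p_opcyclesMap_assoc,
      HomologicalComplex.pOpcycles_singleObjOpcyclesSelfIso_inv,
      HomologicalComplex.mkHomToSingle_f, Category.assoc, Category.assoc, Iso.inv_hom_id,
      Category.comp_id]
  rw [← HomologicalComplex.homologyι_singleObjOpcyclesSelfIso_inv,
    HomologicalComplex.homologyι_naturality_assoc, h, Injective.comp_factorThru]

end

namespace DerivedProLeftAdjointAt

variable {G : A ⥤ B} [G.Additive] [PreservesFiniteLimits G] [PreservesFiniteColimits G] {X : B}
  (L : DerivedProLeftAdjointAt G ((HomologicalComplex.single B (ComplexShape.up ℤ) 0).obj X))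

lemma piZeroUnit_eq (i : L.I) : L.piZeroUnit i =
    (HomologicalComplex.singleObjHomologySelfIso (ComplexShape.up ℤ) 0 X).inv ≫
      homologyZeroMap (HoDiag.eval L.unit i) ≫ (mapChHomologyIso G (L.K.obj i)).hom := by
  have aux {X₁ X₂ X₃ X₄ X₅ X₆ : B} (a : X₁ ⟶ X₂) (b : X₂ ⟶ X₃) (c : X₃ ⟶ X₄) (d : X₄ ⟶ X₅)
      (e : X₅ ⟶ X₆) : a ≫ b ≫ c ≫ d ≫ e = a ≫ (b ≫ c ≫ d) ≫ e := by simp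
  exact aux _ _ _ _ _

lemma piZeroUnit_comp_map_homologyZeroMap (i : L.I) {M : CochainComplex A ℤ}
    (g : Q.obj (L.K.obj i) ⟶ Q.obj M) :
    L.piZeroUnit i ≫ G.map (homologyZeroMap g) =
      (HomologicalComplex.singleObjHomologySelfIso (ComplexShape.up ℤ) 0 X).inv ≫
        homologyZeroMap (HoDiag.eval L.unit i ≫ mapDerived G g) ≫ (mapChHomologyIso G M).hom := by
  rw [piZeroUnit_eq, Category.assoc, Category.assoc, ← homologyZeroMap_mapDerived,
    homologyZeroMap_comp, Category.assoc]

lemma piZeroUnit_naturality {i j : L.I} (φ : i ⟶ j) :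
    L.piZeroUnit i ≫ G.map (HomologicalComplex.homologyMap (L.K.map φ) 0) = L.piZeroUnit j := by
  have h := HoDiag.eval_naturality L.unit φ
  rw [← homologyZeroMap_Q_map, piZeroUnit_comp_map_homologyZeroMap, piZeroUnit_eq,
    mapDerived_Q_map]
  have h' : HoDiag.eval L.unit i ≫ Q.map ((mapCh G).map (L.K.map φ)) = HoDiag.eval L.unit j := by
    refine h.trans ((congrArg (· ≫ _) ?_).trans (Category.id_comp _))
    exact Q.map_id _
  exact congrArg (fun t => _ ≫ homologyZeroMap t ≫ _) h'

lemma exists_piZeroUnit_comp_eq {Y : A} (f : X ⟶ G.obj Y) :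
    ∃ (i : L.I) (u : (L.K.obj i).homology 0 ⟶ Y), L.piZeroUnit i ≫ G.map u = f := by
  let S := (HomologicalComplex.single B (ComplexShape.up ℤ) 0)
  let s (X : B) := HomologicalComplex.singleObjHomologySelfIso (ComplexShape.up ℤ) 0 X
  let s' := HomologicalComplex.singleObjHomologySelfIso (ComplexShape.up ℤ) 0 Y
  let θ : S.obj (G.obj Y) ≅
      (mapCh G).obj ((HomologicalComplex.single A (ComplexShape.up ℤ) 0).obj Y) :=
    ((HomologicalComplex.singleMapHomologicalComplex G (ComplexShape.up ℤ) 0).app Y).symm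
  -- `δ` compares two identifications of `H⁰` with `G Y`. Correcting `f` by `inv δ` makes its
  -- invertibility sufficient.
  let δ : G.obj Y ⟶ G.obj Y := (s _).inv ≫ HomologicalComplex.homologyMap θ.hom 0 ≫
    (mapChHomologyIso G _).hom ≫ G.map s'.hom
  have : IsIso δ := inferInstance
  obtain ⟨i, g, hg⟩ := L.surjective _ (Q.map (S.map (f ≫ inv δ) ≫ θ.hom))
  refine ⟨i, homologyZeroMap g ≫ s'.hom, ?_⟩
  rw [G.map_comp, ← Category.assoc, piZeroUnit_comp_map_homologyZeroMap, hg,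
    homologyZeroMap_Q_map, HomologicalComplex.homologyMap_comp]
  have h := HomologicalComplex.singleObjHomologySelfIso_inv_naturality_assoc (ComplexShape.up ℤ) 0
    (f ≫ inv δ) (HomologicalComplex.homologyMap θ.hom 0 ≫ (mapChHomologyIso G _).hom ≫ G.map s'.hom)
  simp only [Category.assoc] at h ⊢
  refine h.trans ?_
  change f ≫ inv δ ≫ δ = f
  rw [IsIso.inv_hom_id, Category.comp_id]

/-- A map from `H⁰ K` to `Y` need not come from a map `K ⟶ Y[0]`, but it does once `Y` is embedded
in an injective `J`. The resulting morphism `X[0] ⟶ G(J)[0]` vanishes because it does so on `H⁰`,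
and injectivity for `L` kills the map over some `i'`. -/
lemma exists_homologyMap_comp_eq_zero [EnoughInjectives A] {Y : A} {i : L.I}
    (w : (L.K.obj i).homology 0 ⟶ Y) (hw : L.piZeroUnit i ≫ G.map w = 0) :
    ∃ (i' : L.I) (φ : i' ⟶ i), HomologicalComplex.homologyMap (L.K.map φ) 0 ≫ w = 0 := by
  let J := Injective.under Y
  let s' := HomologicalComplex.singleObjHomologySelfIso (ComplexShape.up ℤ) 0 J
  obtain ⟨f, hf⟩ := exists_homologyMap_single_eq (L.K.obj i) (w ≫ Injective.ι Y)
  let θ := (HomologicalComplex.singleMapHomologicalComplex G (ComplexShape.up ℤ) 0).app J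
  have hf' : HomologicalComplex.homologyMap f 0 = w ≫ Injective.ι Y ≫ s'.inv := by
    rw [← cancel_mono s'.hom, hf]
    simp
  have h₀ : homologyZeroMap (HoDiag.eval L.unit i ≫ mapDerived G (Q.map f)) = 0 := by
    have h := L.piZeroUnit_comp_map_homologyZeroMap i (Q.map f)
    rw [homologyZeroMap_Q_map, hf', G.map_comp, reassoc_of% hw, zero_comp] at h
    rw [← cancel_mono (mapChHomologyIso G _).hom, ← cancel_epi
      (HomologicalComplex.singleObjHomologySelfIso (ComplexShape.up ℤ) 0 X).inv, zero_comp,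
      comp_zero]
    exact h.symm
  have h₁ : (HoDiag.eval L.unit i ≫ mapDerived G (Q.map f)) ≫ Q.map θ.hom = 0 :=
    eq_zero_of_homologyZeroMap_eq_zero _ (by
      refine (homologyZeroMap_comp _ _).trans ?_
      exact (congrArg (· ≫ _) h₀).trans zero_comp)
  have h₂ : HoDiag.eval L.unit i ≫ mapDerived G (Q.map f) = 0 := by
    rw [← cancel_mono (Q.map θ.hom), zero_comp]
    exact h₁
  obtain ⟨i', φ, hφ⟩ := L.injective _ i (Q.map f) (Q.map 0) (by
    rw [h₂, mapDerived_Q_map, Functor.map_zero, Functor.map_zero]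
    exact comp_zero.symm)
  refine ⟨i', φ, ?_⟩
  have h₃ := congrArg homologyZeroMap hφ
  rw [homologyZeroMap_comp, homologyZeroMap_comp, homologyZeroMap_Q_map, homologyZeroMap_Q_map,
    homologyZeroMap_Q_map, HomologicalComplex.homologyMap_zero, comp_zero, hf'] at h₃
  rw [← cancel_mono (Injective.ι Y ≫ s'.inv), Category.assoc, h₃, zero_comp]

end DerivedProLeftAdjointAt

lemma isProLeftDerivedFunctor [EnoughInjectives A] {G : A ⥤ B} [G.Additive]
    [PreservesFiniteLimits G] [PreservesFiniteColimits G] (F : ProLeftAdjoint G)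
    (LF : DerivedProLeftAdjoint G) : IsProLeftDerivedFunctor LF F := by
  intro X
  let L := LF ((HomologicalComplex.single B (ComplexShape.up ℤ) 0).obj X)
  refine F.exists_formalLim_iso X
    (L.K ⋙ HomologicalComplex.homologyFunctor A (ComplexShape.up ℤ) 0) L.piZeroUnit
    (fun _ _ φ => L.piZeroUnit_naturality φ) (fun _ f => L.exists_piZeroUnit_comp_eq f)
    (fun i _ u u' h => ?_)
  have aux {V W Z : A} {U : B} (t : U ⟶ G.obj V) (u u' : V ⟶ W) (φ : Z ⟶ V) :
      (t ≫ G.map u = t ≫ G.map u' → t ≫ G.map (u - u') = 0) ∧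
        (φ ≫ (u - u') = 0 → φ ≫ u = φ ≫ u') := by
    rw [G.map_sub, Preadditive.comp_sub, sub_eq_zero, Preadditive.comp_sub, sub_eq_zero]
    exact ⟨id, id⟩
  obtain ⟨i', φ, hφ⟩ := L.exists_homologyMap_comp_eq_zero _ ((aux _ u u' (𝟙 _)).1 h)
  exact ⟨i', φ, (aux (L.piZeroUnit i) u u' _).2 hφ⟩

end

end

theorem theoremA {A : Type u₁} [Category.{v} A] [Abelian A] [IsGrothendieckAbelian.{v} A]
    {B : Type u₂} [Category.{v} B] [Abelian B] [IsGrothendieckAbelian.{v} B]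
    (G : A ⥤ B) [G.Additive] [PreservesFiniteLimits G] [PreservesFiniteColimits G]
    [PreservesFilteredColimitsOfSize.{v, v} G]
    (E : ObjectProperty B) (hE : IsGeneratedBy E)
    (hadm : ∀ P : B, E P →
      IsBCAdmissible G ((HomologicalComplex.single B (ComplexShape.up ℤ) 0).obj P)) :
    Nonempty (ProLeftAdjoint G) ∧ Nonempty (DerivedProLeftAdjoint G) ∧
      ∀ (F : ProLeftAdjoint G) (LF : DerivedProLeftAdjoint G), IsProLeftDerivedFunctor LF F := by
  exact ⟨nonempty_proLeftAdjoint_of_preservesFiniteLimits G,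
    nonempty_derivedProLeftAdjoint G E hE hadm, fun F LF => isProLeftDerivedFunctor F LF⟩
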